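/- **Theorem 1.** Let $\mu$ be a probability measure on $\mathbb R$ which is symmetric, that is $\int_{[-K,K]}x\,d\mu(x)=0$ for every $K>0$, and suppose that for some $\delta>0$ and some constant $C$ one has $\mu((-R,R)^c)\le C R^{-\delta}$ for all sufficiently large $R$. Let $(\omega_n)_{n\ge 1}$ be independent random variables with common law $\mu$ on a probability space $(\Omega,\mathbb P)$, and let $(a_n)_{n\ge1}$ be real numbers with $a_n\sim n^{-\alpha}$, in the sense that $c\,n^{-\alpha}\le |a_n|\le c'n^{-\alpha}$ for some constants $c,c'>0$ and all large $n$ (in particular this covers $a_n n^{\alpha}\to1$). On $\ell^2(\mathbb N)$, $\mathbb N=\{1,2,\dots\}$, consider $$(H^\omega u)_n=u_{n+1}+u_{n-1}+a_n\omega_nu_n\quad(n>1),\qquad (H^\omega u)_1=u_2+a_1\omega_1u_1,$$ let $H^\omega_L$ be its restriction to $\ell^2(\{1,\dots,L\})$, and for $E_0\in\mathbb R$ let $\xi^\omega_{E_0,L}$ be the random point measure on $\mathbb R$ determined by $$\xi^\omega_{E_0,L}(f)=\mathrm{tr}\, f\big(L(H^\omega_L-E_0)\big),\qquad f\in C_c(\mathbb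 R).$$ Assume $\alpha-\frac1\delta>\frac12$ and $E_0\in(-2,2)$, and let $\theta\in(0,\pi)$ be given by $E_0=2\cos\theta$. Then every strictly increasing sequence $(L_n)$ of natural numbers has a subsequence $(L_{n_k})_k$ for which there is a real random variable $\tilde g^\omega_\theta$ on $\Omega$ such that, as $k\to\infty$, $$\xi^\omega_{E_0,L_{n_k}}\longrightarrow\sum_{j\in\mathbb Z}\delta_{-2(j\pi+\tilde g^\omega_\theta)\sin\theta}$$ in distribution, as random elements of the space of locally finite measures on $\mathbb R$ with the vague topology. -/

import Mathlib

open MeasureTheory ProbabilityTheory Filter Topology Asymptotics Set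
open scoped CompactlySupported

/-! ### The half-line operator -/

/-- The formal difference operator
`(H u)_n = u_{n+1} + u_{n-1} + a_n w_n u_n` (`n > 1`), `(H u)_1 = u_2 + a_1 w_1 u_1`,
on all complex sequences. The index `i : ℕ` stands for the lattice site `n = i + 1`. -/
def jacobiFormal (a w : ℕ → ℝ) : (ℕ → ℂ) →ₗ[ℂ] (ℕ → ℂ) where
  toFun u := fun i =>
    u (i + 1) + (if i = 0 then 0 else u (i - 1)) + ((a i * w i : ℝ) : ℂ) * u i
  map_add' u v := by
    funext i
    by_cases h : i = 0 <;> simp [h] <;> ring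
  map_smul' c u := by
    funext i
    by_cases h : i = 0 <;> simp [h] <;> ring

/-- The Hilbert space of square-summable complex sequences. -/
abbrev EllTwo : Type := lp (fun _ : ℕ => ℂ) 2

/-- The operator `H` on `ℓ²` with its maximal domain `{u ∈ ℓ² | H u ∈ ℓ²}`. -/
noncomputable def halfLineOp (a w : ℕ → ℝ) : EllTwo →ₗ.[ℂ] EllTwo where
  domain :=
    { carrier := {u | Memℓp (jacobiFormal a w (u : ℕ → ℂ)) 2}
      add_mem' := by
        intro u v hu hv
        simp only [mem_ofPred_eq, lp.coeFn_add, map_add] at *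
        exact hu.add hv
      zero_mem' := by
        simp only [mem_ofPred_eq, lp.coeFn_zero, map_zero]
        exact zero_memℓp
      smul_mem' := by
        intro c u hu
        simp only [mem_ofPred_eq, lp.coeFn_smul, map_smul] at *
        exact hu.const_smul c }
  toFun :=
    { toFun := fun u => ⟨jacobiFormal a w (u.1 : ℕ → ℂ), u.2⟩
      map_add' := by
        intro u v
        apply Subtype.ext
        exact map_add (jacobiFormal a w) (u.1 : ℕ → ℂ) (v.1 : ℕ → ℂ)
      map_smul' := by
        intro c u
        apply Subtype.ext
        exact map_smul (jacobiFormal a w) c (u.1 : ℕ → ℂ) }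

/-- The canonical basis vector `δ_j` of `ℓ²`. -/
noncomputable def deltaVec (j : ℕ) : EllTwo := lp.single 2 j (1 : ℂ)

theorem deltaVec_apply (j i : ℕ) : (deltaVec j : ℕ → ℂ) i = if i = j then 1 else 0 := by
  simp [deltaVec, lp.single_apply, Pi.single_apply]

theorem deltaVec_mem_domain (a w : ℕ → ℝ) (j : ℕ) :
    deltaVec j ∈ (halfLineOp a w).domain := by
  change Memℓp (jacobiFormal a w (deltaVec j : ℕ → ℂ)) 2
  refine (memℓp_zero ((Set.finite_Iic (j + 1)).subset ?_)).of_exponent_ge zero_le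
  intro i hi
  by_contra hlt
  rw [mem_Iic, not_le] at hlt
  apply hi
  have h1 : i + 1 ≠ j := by omega
  have h2 : i - 1 ≠ j := by omega
  have h3 : i ≠ j := by omega
  simp [jacobiFormal, deltaVec_apply, h1, h2, h3]

/-- The restriction `H_L` of `H` to `ℓ²({1, …, L})`: the matrix with entries `⟨δ_i, H δ_j⟩`,
where `i, j` run over the first `L` sites. -/
noncomputable def boxOp (a w : ℕ → ℝ) (L : ℕ) : Matrix (Fin L) (Fin L) ℂ :=
  Matrix.of fun i j =>
    inner ℂ (deltaVec i) (halfLineOp a w ⟨deltaVec j, deltaVec_mem_domain a w j⟩)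

theorem boxOp_apply (a w : ℕ → ℝ) (L : ℕ) (i j : Fin L) :
    boxOp a w L i j =
      (if (i : ℕ) + 1 = j then 1 else 0) + (if (j : ℕ) + 1 = i then 1 else 0) +
        (if i = j then ((a i * w i : ℝ) : ℂ) else 0) := by
  have h : boxOp a w L i j = jacobiFormal a w (deltaVec j : ℕ → ℂ) i := by
    simp only [boxOp, Matrix.of_apply]
    rw [deltaVec, lp.inner_single_left]
    simp only [RCLike.inner_apply, map_one, mul_one]
    rfl
  rw [h]
  simp only [jacobiFormal, LinearMap.coe_mk, AddHom.coe_mk, deltaVec_apply, Fin.ext_iff]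
  by_cases hi : (i : ℕ) = 0
  · have : ¬ ((j : ℕ) + 1 = i) := by omega
    simp [hi]
  · have : ((i : ℕ) - 1 = j) ↔ ((j : ℕ) + 1 = i) := by omega
    simp [hi, this]

/-- The rescaled matrix `L (H_L - E₀)`. -/
noncomputable def rescaledBoxOp (a w : ℕ → ℝ) (E₀ : ℝ) (L : ℕ) : Matrix (Fin L) (Fin L) ℂ :=
  (L : ℂ) • (boxOp a w L - (E₀ : ℂ) • (1 : Matrix (Fin L) (Fin L) ℂ))

theorem rescaledBoxOp_isHermitian (a w : ℕ → ℝ) (E₀ : ℝ) (L : ℕ) :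
    (rescaledBoxOp a w E₀ L).IsHermitian := by
  ext i j
  simp only [rescaledBoxOp, Matrix.conjTranspose_apply, Matrix.smul_apply, Matrix.sub_apply,
    boxOp_apply, Matrix.one_apply, smul_eq_mul]
  by_cases h : i = j
  · subst h
    simp
  · have h' : ¬ j = i := fun e => h e.symm
    simp only [h, h']
    by_cases h1 : (i : ℕ) + 1 = j <;> by_cases h2 : (j : ℕ) + 1 = i <;> simp [h1, h2]

/-! ### Locally finite measures on the line with the vague topology -/

/-- The space of locally finite Borel measures on `ℝ`. -/
def LocFinMeasure : Type := {m : Measure ℝ // IsLocallyFiniteMeasure m}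

/-- The vague topology: the coarsest topology for which `m ↦ ∫ f dm` is continuous for every
continuous compactly supported `f`. -/
noncomputable instance LocFinMeasure.instTopologicalSpace : TopologicalSpace LocFinMeasure :=
  TopologicalSpace.induced (fun (m : LocFinMeasure) (f : C_c(ℝ, ℝ)) => ∫ x, f x ∂m.1) inferInstance

/-- The Borel σ-algebra of the vague topology. -/
noncomputable instance LocFinMeasure.instMeasurableSpace : MeasurableSpace LocFinMeasure :=
  borel LocFinMeasure

instance LocFinMeasure.instBorelSpace : BorelSpace LocFinMeasure := ⟨rfl⟩

/-! ### The eigenvalue point process and the clock process -/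

/-- The point measure `ξ_{E₀,L} = ∑ δ_λ`, the sum running over the eigenvalues `λ`, with
multiplicity, of `L (H_L - E₀)`. -/
noncomputable def eigenvalueProcess (a w : ℕ → ℝ) (E₀ : ℝ) (L : ℕ) : LocFinMeasure :=
  ⟨Measure.sum fun i : Fin L =>
      Measure.dirac ((rescaledBoxOp_isHermitian a w E₀ L).eigenvalues i),
    by rw [Measure.sum_fintype]; infer_instance⟩

/-- The point measure is the one determined by `ξ_{E₀,L}(f) = tr f(L (H_L - E₀))`. -/
theorem integral_eigenvalueProcess (a w : ℕ → ℝ) (E₀ : ℝ) (L : ℕ) (f : C_c(ℝ, ℝ)) :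
    ((∫ x, f x ∂(eigenvalueProcess a w E₀ L).1 : ℝ) : ℂ) =
      Matrix.trace (cfc (fun x : ℝ => f x) (rescaledBoxOp a w E₀ L)) := by
  have hA := rescaledBoxOp_isHermitian a w E₀ L
  have h1 : ∫ x, f x ∂(eigenvalueProcess a w E₀ L).1 = ∑ i, f (hA.eigenvalues i) := by
    simp only [eigenvalueProcess, Measure.sum_fintype]
    rw [integral_finsetSum_measure]
    · simp
    · intro i _
      exact integrable_dirac (by finiteness)
  rw [h1, hA.cfc_eq, Matrix.IsHermitian.cfc, Unitary.conjStarAlgAut_apply, Matrix.trace_mul_comm,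
    ← mul_assoc]
  simp [Matrix.trace_diagonal]

/-- The points `-2 (k π + φ) sin θ` have no accumulation point. -/
theorem isLocallyFiniteMeasure_clock (θ : ℝ) (hθ : θ ∈ Ioo 0 Real.pi) (φ : ℝ) :
    IsLocallyFiniteMeasure (Measure.sum fun k : ℤ =>
      Measure.dirac (-2 * ((k : ℝ) * Real.pi + φ) * Real.sin θ)) := by
  have hs : 0 < Real.sin θ := Real.sin_pos_of_mem_Ioo hθ
  have hc : 0 < 2 * Real.pi * Real.sin θ := by positivity
  refine ⟨fun x => ⟨Metric.ball x 1, Metric.ball_mem_nhds x one_pos, ?_⟩⟩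
  rw [Measure.sum_apply _ measurableSet_ball]
  set p : ℤ → ℝ := fun k => -2 * ((k : ℝ) * Real.pi + φ) * Real.sin θ with hp
  have hfin : {k : ℤ | p k ∈ Metric.ball x 1}.Finite := by
    set b : ℝ := -2 * φ * Real.sin θ - x
    refine (Set.finite_Icc ⌊(b - 1) / (2 * Real.pi * Real.sin θ)⌋
      ⌈(b + 1) / (2 * Real.pi * Real.sin θ)⌉).subset ?_
    intro k hk
    rw [mem_ofPred_eq, Metric.mem_ball, Real.dist_eq, abs_lt] at hk
    have e : p k - x = b - k * (2 * Real.pi * Real.sin θ) := by simp only [hp, b]; ring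
    rw [e] at hk
    constructor
    · have : (b - 1) / (2 * Real.pi * Real.sin θ) ≤ k := by
        rw [div_le_iff₀ hc]; linarith [hk.2]
      exact_mod_cast (Int.floor_le _).trans this
    · have : (k : ℝ) ≤ (b + 1) / (2 * Real.pi * Real.sin θ) := by
        rw [le_div_iff₀ hc]; linarith [hk.1]
      exact_mod_cast this.trans (Int.le_ceil _)
  rw [tsum_eq_sum (s := hfin.toFinset)]
  · exact ENNReal.sum_lt_top.2 fun k _ => measure_lt_top _ _
  · intro k hk
    rw [Measure.dirac_apply' _ measurableSet_ball]
    have hk' : p k ∉ Metric.ball x 1 := fun h => hk (hfin.mem_toFinset.2 h)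
    exact Set.indicator_of_notMem hk' _

/-- The clock configuration `∑_{k ∈ ℤ} δ_{-2 (k π + φ) sin θ}` with phase `φ`. -/
noncomputable def clockMeasure (θ : ℝ) (hθ : θ ∈ Ioo 0 Real.pi) (φ : ℝ) : LocFinMeasure :=
  ⟨Measure.sum fun k : ℤ => Measure.dirac (-2 * ((k : ℝ) * Real.pi + φ) * Real.sin θ),
    isLocallyFiniteMeasure_clock θ hθ φ⟩

/-! Written in the basis `cos (n θ)`, `sin (n θ)` of free solutions, the difference equation at
energy `E₀` has transfer matrices `1 - a j * ω j • siteMat θ j`. The gap in `α - 1/δ > 1/2` leaves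
room for a truncation of `ω n` at height `(n + 1) ^ γ`, where `1/δ < γ < α - 1/2`. By Borel–Cantelli
the truncation almost surely changes finitely many terms. The truncated variables are centred by
symmetry and have summable second moments after multiplication by `a n`. The product of transfer
matrices is then a martingale bounded in L², so it converges almost surely to a matrix `T` of
determinant one (`ae_exists_tendsto_transferMat`).

Passing to the energy `E₀ + z / L` adds `(z / L) • siteMat θ j` to the `j`-th factor. Up to terms
oscillating with frequency `2 θ`, `siteMat` is `(2 sin θ)⁻¹` times the rotation generator `J`. The
oscillating part has bounded sums and disappears at scale `1 / L`, so the product over `L` sites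
tends to `exp (z J / (2 sin θ)) * T` (`tendsto_orderedProd_add_smul`). The normalized characteristic
polynomial is read off from the second column at angle `(L + 1) θ`. Its limit is a nonzero multiple
of `sin (z / (2 sin θ) + g)`, provided that `(L + 1) θ` converges modulo `2 π`; this is the only
reason for passing to a subsequence (`tendsto_charSeq`).

The convergence is locally uniform in complex `z`, so derivatives converge as well. The zeros of the
limit are real and simple, hence the rescaled eigenvalues converge to them as point measures
(`tendsto_integral_of_roots`, `tendsto_eigenvalueProcess`). This holds almost surely along one
deterministic subsequence, and convergence in distribution follows. -/

/-! ### Ordered products in a normed algebra -/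

/-- The ordered product `A (n - 1) * ⋯ * A 0`. -/
def orderedProd {R : Type*} [Monoid R] (A : ℕ → R) : ℕ → R
  | 0 => 1
  | n + 1 => A n * orderedProd A n

section OrderedProd

variable {R : Type*} [NormedRing R] [NormedAlgebra ℂ R] [NormOneClass R]

theorem norm_one_add_smul_pow_le (h : ℂ) {K : ℝ} {b : R} (hb : ‖b‖ ≤ K) (m : ℕ) :
    ‖(1 + h • b) ^ m‖ ≤ (1 + ‖h‖ * K) ^ m := by
  refine (norm_pow_le _ _).trans (pow_le_pow_left₀ (norm_nonneg _) ?_ m)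
  refine (norm_add_le _ _).trans ?_
  rw [norm_one, norm_smul]
  gcongr

/-- Summation by parts: an ordered product of factors `1 + h • B j` is close to the power of
`1 + h • b` when the partial sums of `h • (B j - b)` are small. -/
theorem norm_orderedProd_sub_pow_le (B : ℕ → R) (b : R) (h : ℂ) {K ε M : ℝ} (N : ℕ)
    (hB : ∀ j, ‖B j‖ ≤ K) (hb : ‖b‖ ≤ K) (hM : ‖h‖ * K * N ≤ M)
    (hε : ∀ m ≤ N, ‖h • ∑ j ∈ Finset.range m, (B j - b)‖ ≤ ε) :
    ‖orderedProd (fun j => 1 + h • B j) N - (1 + h • b) ^ N‖ ≤ 3 * ε * Real.exp M ^ 2 := by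
  have hK : 0 ≤ K := (norm_nonneg _).trans hb
  have hx : 0 ≤ ‖h‖ * K := by positivity
  have hε0 : 0 ≤ ε := (norm_nonneg _).trans (hε 0 (Nat.zero_le _))
  have hpow : ∀ m ≤ N, (1 + ‖h‖ * K) ^ m ≤ Real.exp M := by
    intro m hm
    calc (1 + ‖h‖ * K) ^ m ≤ Real.exp (‖h‖ * K) ^ m := by
          gcongr
          linarith [Real.add_one_le_exp (‖h‖ * K)]
      _ = Real.exp (m * (‖h‖ * K)) := (Real.exp_nat_mul _ _).symm
      _ ≤ Real.exp M := by
          refine Real.exp_le_exp.2 (le_trans ?_ hM)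
          rw [mul_comm]
          gcongr
  have hE1 : 1 ≤ Real.exp M := by simpa using hpow 0 (Nat.zero_le _)
  have hY : ∀ m ≤ N, ‖(1 + h • b) ^ m‖ ≤ Real.exp M := fun m hm =>
    (norm_one_add_smul_pow_le h hb m).trans (hpow m hm)
  set Q := orderedProd (fun j => 1 + h • B j) with hQ
  set S : ℕ → R := fun m => h • ∑ j ∈ Finset.range m, (B j - b) with hS
  -- Subtracting the first-order correction `S m * Y` removes the term `h • (B m - b)`, which is not
  -- small step by step. What remains satisfies a discrete Gronwall inequality with source `2 * ‖h‖
  -- * K * ε * exp M`.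
  have key : ∀ m ≤ N, ‖Q m - (1 + h • b) ^ m - S m * (1 + h • b) ^ m‖ ≤
      ((1 + ‖h‖ * K) ^ m - 1) * (2 * ε * Real.exp M) := by
    intro m
    induction m with
    | zero => intro _; simp [hQ, hS, orderedProd]
    | succ m ih =>
      intro hm
      have ih' := ih (by omega)
      set Y := (1 + h • b) ^ m with hYd
      set D := Q m - Y - S m * Y with hD
      have e : Q (m + 1) - (1 + h • b) ^ (m + 1) - S (m + 1) * (1 + h • b) ^ (m + 1) =
          D + h • (B m * D) + (h • (B m * (S m * Y)) - h • (S (m + 1) * (b * Y))) := by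
        have h1 : Q (m + 1) = (1 + h • B m) * Q m := rfl
        have h2 : S (m + 1) = S m + h • (B m - b) := by
          simp only [hS, Finset.sum_range_succ, smul_add]
        rw [h1, pow_succ', h2, ← hYd, hD]
        simp only [add_mul, mul_sub, smul_sub, sub_mul, mul_add, smul_add, one_mul,
          smul_mul_assoc, mul_smul_comm]
        abel
      rw [e]
      have n1 : ‖h • (B m * D)‖ ≤ ‖h‖ * K * ‖D‖ := by
        rw [norm_smul, mul_assoc]
        gcongr
        exact (norm_mul_le _ _).trans (by gcongr; exact hB m)
      have n2 : ‖h • (B m * (S m * Y))‖ ≤ ‖h‖ * K * (ε * Real.exp M) := by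
        rw [norm_smul, mul_assoc]
        gcongr
        refine (norm_mul_le _ _).trans ?_
        gcongr
        · exact hB m
        · refine (norm_mul_le _ _).trans ?_
          gcongr
          · exact hε m (by omega)
          · exact hY m (by omega)
      have n3 : ‖h • (S (m + 1) * (b * Y))‖ ≤ ‖h‖ * K * (ε * Real.exp M) := by
        rw [norm_smul]
        have : ‖S (m + 1) * (b * Y)‖ ≤ ε * (K * Real.exp M) := by
          refine (norm_mul_le _ _).trans ?_
          gcongr
          · exact hε (m + 1) hm
          · refine (norm_mul_le _ _).trans ?_
            gcongr
            exact hY m (by omega)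
        calc ‖h‖ * ‖S (m + 1) * (b * Y)‖ ≤ ‖h‖ * (ε * (K * Real.exp M)) := by gcongr
          _ = _ := by ring
      calc _ ≤ ‖D‖ + ‖h‖ * K * ‖D‖ +
            (‖h‖ * K * (ε * Real.exp M) + ‖h‖ * K * (ε * Real.exp M)) := by
            refine (norm_add_le _ _).trans (add_le_add ((norm_add_le _ _).trans ?_)
              ((norm_sub_le _ _).trans (add_le_add n2 n3)))
            gcongr
        _ = (1 + ‖h‖ * K) * ‖D‖ + ‖h‖ * K * (2 * ε * Real.exp M) := by ring
        _ ≤ (1 + ‖h‖ * K) * (((1 + ‖h‖ * K) ^ m - 1) * (2 * ε * Real.exp M)) +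
            ‖h‖ * K * (2 * ε * Real.exp M) := by gcongr
        _ = _ := by ring
  have hN := key N le_rfl
  have hSN : ‖S N * (1 + h • b) ^ N‖ ≤ ε * Real.exp M := by
    refine (norm_mul_le _ _).trans ?_
    gcongr
    · exact hε N le_rfl
    · exact hY N le_rfl
  have e : Q N - (1 + h • b) ^ N =
      (Q N - (1 + h • b) ^ N - S N * (1 + h • b) ^ N) + S N * (1 + h • b) ^ N := by abel
  rw [e]
  calc _ ≤ ((1 + ‖h‖ * K) ^ N - 1) * (2 * ε * Real.exp M) + ε * Real.exp M :=
        (norm_add_le _ _).trans (add_le_add hN hSN)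
    _ ≤ Real.exp M * (2 * ε * Real.exp M) + ε * Real.exp M * Real.exp M := by
        gcongr
        · linarith [hpow N le_rfl]
        · exact le_mul_of_one_le_right (by positivity) hE1
    _ = _ := by ring

/-- If the Cesàro means of `E` tend to zero, then `L⁻¹ * ∑ j < m, E j` is eventually small,
uniformly in `m ≤ L`. -/
theorem eventually_norm_sum_le {V : Type*} [SeminormedAddCommGroup V] {E : ℕ → V}
    (hE : Tendsto (fun n : ℕ => (n : ℝ)⁻¹ * ‖∑ j ∈ Finset.range n, E j‖) atTop (𝓝 0))
    {ε : ℝ} (hε : 0 < ε) :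
    ∀ᶠ N : ℕ in atTop, ∀ m ≤ N, ‖∑ j ∈ Finset.range m, E j‖ ≤ ε * N := by
  obtain ⟨n₀, hn₀⟩ := eventually_atTop.1 (hE.eventually (gt_mem_nhds hε))
  set C := ∑ m ∈ Finset.range (n₀ + 1), ‖∑ j ∈ Finset.range m, E j‖ with hC
  have hbig : ∀ᶠ N : ℕ in atTop, C ≤ ε * N :=
    (tendsto_natCast_atTop_atTop.const_mul_atTop hε).eventually_ge_atTop C
  filter_upwards [hbig] with N hN m hm
  rcases le_or_gt m n₀ with h | h
  · refine le_trans ?_ hN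
    exact Finset.single_le_sum (f := fun m => ‖∑ j ∈ Finset.range m, E j‖)
      (fun _ _ => norm_nonneg _) (Finset.mem_range.2 (by omega))
  · have h1 := hn₀ m h.le
    have hmpos : (0 : ℝ) < m := by exact_mod_cast (by omega : 0 < m)
    rw [inv_mul_lt_iff₀ hmpos] at h1
    have : (m : ℝ) ≤ N := by exact_mod_cast hm
    nlinarith

/-- Averaging: at step size `1 / L` only the Cesàro mean of `B` matters. The filter `l` is arbitrary
so that `z` may vary together with `L`, which later yields locally uniform convergence. -/
theorem tendsto_orderedProd_sub_pow {ι : Type*} {l : Filter ι} (L : ι → ℕ) (hL : Tendsto L l atTop)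
    {z : ι → ℂ} {z₀ : ℂ} (hz : Tendsto z l (𝓝 z₀)) (B : ℕ → R) (b : R) {K : ℝ}
    (hB : ∀ j, ‖B j‖ ≤ K) (hb : ‖b‖ ≤ K)
    (hE : Tendsto (fun n : ℕ => (n : ℝ)⁻¹ * ‖∑ j ∈ Finset.range n, (B j - b)‖) atTop (𝓝 0)) :
    Tendsto (fun i => orderedProd (fun j => 1 + (z i / L i) • B j) (L i) -
      (1 + (z i / L i) • b) ^ L i) l (𝓝 0) := by
  have hK : 0 ≤ K := (norm_nonneg _).trans hb
  rw [tendsto_zero_iff_norm_tendsto_zero]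
  rw [Metric.tendsto_nhds]
  intro η hη
  set Z := ‖z₀‖ + 1 with hZ
  have hZ0 : 0 < Z := by positivity
  -- Chosen so that the bound `3 * (Z * ε) * exp (Z * K) ^ 2` equals `η / 2`.
  set ε := η / (6 * Z * Real.exp (Z * K) ^ 2) with hεd
  have hε : 0 < ε := by positivity
  have hzb : ∀ᶠ i in l, ‖z i‖ < Z :=
    hz.norm.eventually (gt_mem_nhds (by simp [hZ]))
  filter_upwards [hzb, hL.eventually (eventually_norm_sum_le hE hε), hL.eventually_gt_atTop 0]
    with i hi hsum hpos
  have hLpos : (0 : ℝ) < L i := by exact_mod_cast hpos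
  have hh : ‖z i / L i‖ = ‖z i‖ / L i := by simp
  have := norm_orderedProd_sub_pow_le B b (z i / L i) (K := K) (ε := Z * ε) (M := Z * K) (L i)
    hB hb ?_ ?_
  · rw [dist_zero_right, norm_norm]
    refine this.trans_lt ?_
    have : 3 * (Z * ε) * Real.exp (Z * K) ^ 2 = η / 2 := by
      rw [hεd]; field_simp; norm_num
    rw [this]; linarith
  · rw [hh]
    have : ‖z i‖ / L i * K * L i = ‖z i‖ * K := by field_simp
    rw [this]; gcongr
  · intro m hm
    rw [norm_smul, hh, div_mul_eq_mul_div, div_le_iff₀ hLpos, mul_assoc]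
    exact mul_le_mul hi.le (hsum m hm) (norm_nonneg _) hZ0.le

end OrderedProd

/-- The exponential limit `(1 + w / L) ^ L → exp w₀` along a general filter. -/
theorem Complex.tendsto_one_add_div_pow {ι : Type*} {l : Filter ι} (L : ι → ℕ)
    (hL : Tendsto L l atTop) {w : ι → ℂ} {w₀ : ℂ} (hw : Tendsto w l (𝓝 w₀)) :
    Tendsto (fun i => (1 + w i / L i) ^ L i) l (𝓝 (Complex.exp w₀)) := by
  have h0 : Tendsto (fun i => w i / (L i : ℂ)) l (𝓝 0) := by
    have : Tendsto (fun i => ((L i : ℕ) : ℂ)⁻¹) l (𝓝 0) :=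
      (tendsto_inv_atTop_nhds_zero_nat (𝕜 := ℂ)).comp hL
    simpa [div_eq_mul_inv] using hw.mul this
  have hlog : Tendsto (fun i => (L i : ℂ) * Complex.log (1 + w i / L i)) l (𝓝 w₀) := by
    have hd : HasDerivAt (fun x : ℂ => Complex.log (1 + x)) 1 0 := by
      have := (HasDerivAt.const_add (1 : ℂ) (hasDerivAt_id (0 : ℂ))).clog (by simp)
      simpa using this
    have ho := hd.isLittleO
    simp only [add_zero, Complex.log_one, sub_zero, smul_eq_mul, mul_one] at ho
    have ho' := ho.comp_tendsto h0
    have h1 : (fun i => (L i : ℂ) * (Complex.log (1 + w i / L i) - w i / L i)) =o[l]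
        fun i => (L i : ℂ) * (w i / L i) :=
      (isBigO_refl (fun i => (L i : ℂ)) l).mul_isLittleO ho'
    have hne : ∀ᶠ i in l, (L i : ℂ) ≠ 0 := by
      filter_upwards [hL.eventually_gt_atTop 0] with i hi
      exact_mod_cast hi.ne'
    have h2 : (fun i => (L i : ℂ) * (w i / L i)) =ᶠ[l] w := by
      filter_upwards [hne] with i hi
      field_simp
    have h3 : Tendsto (fun i => (L i : ℂ) * (Complex.log (1 + w i / L i) - w i / L i)) l
        (𝓝 0) := by
      rw [← isLittleO_one_iff ℝ]
      exact (h1.congr' EventuallyEq.rfl h2).trans_isBigO (hw.isBigO_one ℝ)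
    have h4 := h3.add (hw.congr' h2.symm)
    rw [zero_add] at h4
    refine h4.congr fun i => ?_
    ring
  refine (Complex.continuous_exp.continuousAt.tendsto.comp hlog).congr' ?_
  have hne : ∀ᶠ i in l, 1 + w i / (L i : ℂ) ≠ 0 := by
    have : Tendsto (fun i => 1 + w i / (L i : ℂ)) l (𝓝 1) := by simpa using h0.const_add 1
    exact this.eventually_ne one_ne_zero
  filter_upwards [hne] with i hi
  rw [Function.comp_apply, Complex.exp_nat_mul, Complex.exp_log hi]

/-- Replacing `S j`, `T j` by their limits costs an error tending to zero, whose Cesàro means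
vanish. The rest is the bounded sum of `M j - N` between fixed factors, divided by `n`. -/
theorem tendsto_inv_mul_norm_sum_conj {R : Type*} [NormedRing R] {M T S : ℕ → R}
    {N T' S' : R} {K C : ℝ} (hM : ∀ j, ‖M j‖ ≤ K)
    (hsum : ∀ n, ‖∑ j ∈ Finset.range n, (M j - N)‖ ≤ C)
    (hT : Tendsto T atTop (𝓝 T')) (hS : Tendsto S atTop (𝓝 S')) :
    Tendsto (fun n : ℕ => (n : ℝ)⁻¹ *
      ‖∑ j ∈ Finset.range n, (S j * M j * T j - S' * N * T')‖) atTop (𝓝 0) := by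
  have hd : Tendsto (fun j => ‖S j * M j * T j - S' * M j * T'‖) atTop (𝓝 0) := by
    obtain ⟨CT, hCT⟩ := hT.norm.bddAbove_range
    have hCT' : ∀ j, ‖T j‖ ≤ CT := fun j => hCT ⟨j, rfl⟩
    have hS0 : Tendsto (fun j => ‖S j - S'‖) atTop (𝓝 0) :=
      tendsto_iff_norm_sub_tendsto_zero.1 hS
    have hT0 : Tendsto (fun j => ‖T j - T'‖) atTop (𝓝 0) :=
      tendsto_iff_norm_sub_tendsto_zero.1 hT
    have hlim : Tendsto (fun j => ‖S j - S'‖ * K * CT + ‖S'‖ * K * ‖T j - T'‖) atTop (𝓝 0) := by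
      simpa using ((hS0.mul_const K).mul_const CT).add (hT0.const_mul (‖S'‖ * K))
    have hK : 0 ≤ K := (norm_nonneg _).trans (hM 0)
    refine squeeze_zero (fun _ => norm_nonneg _) (fun j => ?_) hlim
    have e : S j * M j * T j - S' * M j * T' = (S j - S') * M j * T j + S' * M j * (T j - T') := by
      simp only [sub_mul, mul_sub]; abel
    rw [e]
    refine (norm_add_le _ _).trans (add_le_add ?_ ?_)
    · refine (norm_mul_le _ _).trans ?_
      gcongr
      · exact (norm_mul_le _ _).trans (by gcongr; exact hM j)
      · exact hCT' j
    · refine (norm_mul_le _ _).trans ?_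
      gcongr
      exact (norm_mul_le _ _).trans (by gcongr; exact hM j)
  have hces := hd.cesaro
  have hinv : Tendsto (fun n : ℕ => (n : ℝ)⁻¹ * (‖S'‖ * C * ‖T'‖)) atTop (𝓝 0) := by
    simpa using (tendsto_inv_atTop_nhds_zero_nat (𝕜 := ℝ)).mul_const (‖S'‖ * C * ‖T'‖)
  have hlim := hces.add hinv
  rw [add_zero] at hlim
  refine squeeze_zero (fun _ => by positivity) (fun n => ?_) hlim
  rw [← mul_add]
  gcongr
  have e : ∑ j ∈ Finset.range n, (S j * M j * T j - S' * N * T') =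
      ∑ j ∈ Finset.range n, (S j * M j * T j - S' * M j * T') +
        S' * (∑ j ∈ Finset.range n, (M j - N)) * T' := by
    rw [Finset.mul_sum, Finset.sum_mul, ← Finset.sum_add_distrib]
    refine Finset.sum_congr rfl fun j _ => ?_
    simp only [mul_sub, sub_mul]; abel
  rw [e]
  refine (norm_add_le _ _).trans (add_le_add (norm_sum_le _ _) ?_)
  refine (norm_mul_le _ _).trans ?_
  gcongr
  refine (norm_mul_le _ _).trans ?_
  gcongr
  exact hsum n

/-- Perturbation of a convergent ordered product by `(z / L) • M j`, where `M j` has mean `N`. -/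
theorem tendsto_orderedProd_add_smul {R : Type*} [NormedRing R] [NormedAlgebra ℂ R]
    [NormOneClass R] {ι : Type*} {l : Filter ι} (L : ι → ℕ) (hL : Tendsto L l atTop)
    {z : ι → ℂ} {z₀ : ℂ} (hz : Tendsto z l (𝓝 z₀)) {A M S : ℕ → R} {N T' S' W : R} {K C : ℝ}
    (hM : ∀ j, ‖M j‖ ≤ K) (hsum : ∀ n, ‖∑ j ∈ Finset.range n, (M j - N)‖ ≤ C)
    (hTS : ∀ j, orderedProd A j * S j = 1)
    (hT : Tendsto (orderedProd A) atTop (𝓝 T')) (hS : Tendsto S atTop (𝓝 S'))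
    (hTS' : T' * S' = 1) (hST' : S' * T' = 1)
    (hW : Tendsto (fun i => (1 + (z i / L i) • N) ^ L i) l (𝓝 W)) :
    Tendsto (fun i => orderedProd (fun j => A j + (z i / L i) • M j) (L i)) l (𝓝 (W * T')) := by
  set T := orderedProd A with hTd
  -- Variation of constants: since `S` inverts `T`, factoring `T n` out on the left turns the
  -- perturbation into `B`. The index `j + 1` appears because the factor `A j` is absorbed into `T
  -- (j + 1)`.
  set B : ℕ → R := fun j => S (j + 1) * M j * T j with hB
  have hfac : ∀ (h : ℂ) (n : ℕ), orderedProd (fun j => A j + h • M j) n =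
      T n * orderedProd (fun j => 1 + h • B j) n := by
    intro h n
    induction n with
    | zero => simp [hTd, orderedProd]
    | succ n ih =>
      have h1 : T (n + 1) = A n * T n := rfl
      have h2 : T (n + 1) * (S (n + 1) * M n * T n) = M n * T n := by
        rw [← mul_assoc, ← mul_assoc, hTS, one_mul]
      simp only [orderedProd]
      rw [ih, add_mul, add_mul, mul_add, one_mul, hB]
      simp only [smul_mul_assoc, mul_smul_comm]
      rw [← mul_assoc (T (n + 1)), h2, h1, mul_assoc, mul_assoc]
  have hpow : ∀ (h : ℂ) (n : ℕ), (1 + h • (S' * N * T')) ^ n = S' * (1 + h • N) ^ n * T' := by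
    intro h n
    induction n with
    | zero => simp [hST']
    | succ n ih =>
      rw [pow_succ, ih, pow_succ]
      have : T' * (1 + h • (S' * N * T')) = (1 + h • N) * T' := by
        rw [mul_add, add_mul, mul_one, one_mul, mul_smul_comm, smul_mul_assoc, ← mul_assoc,
          ← mul_assoc, hTS', one_mul]
      rw [mul_assoc, this]
      simp only [mul_assoc]
  have hces := tendsto_inv_mul_norm_sum_conj hM hsum hT ((tendsto_add_atTop_iff_nat 1).2 hS)
  obtain ⟨CT, hCT⟩ := hT.norm.bddAbove_range
  obtain ⟨CS, hCS⟩ := hS.norm.bddAbove_range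
  have hCT' : ∀ j, ‖T j‖ ≤ CT := fun j => hCT ⟨j, rfl⟩
  have hCS' : ∀ j, ‖S j‖ ≤ CS := fun j => hCS ⟨j, rfl⟩
  have hBb : ∀ j, ‖B j‖ ≤ CS * K * CT := by
    intro j
    have hK : 0 ≤ K := (norm_nonneg _).trans (hM 0)
    have hCS0 : 0 ≤ CS := (norm_nonneg _).trans (hCS' 0)
    refine (norm_mul_le _ _).trans ?_
    gcongr
    · refine (norm_mul_le _ _).trans ?_
      gcongr
      · exact hCS' _
      · exact hM j
    · exact hCT' j
  have hlim := tendsto_orderedProd_sub_pow L hL hz B (S' * N * T')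
    (K := max (CS * K * CT) ‖S' * N * T'‖) (fun j => (hBb j).trans (le_max_left _ _))
    (le_max_right _ _) hces
  have hW' : Tendsto (fun i => (1 + (z i / L i) • (S' * N * T')) ^ L i) l
      (𝓝 (S' * W * T')) := by
    simp only [hpow]
    exact (hW.const_mul S').mul_const T'
  have hQ := hlim.add hW'
  simp only [sub_add_cancel, zero_add] at hQ
  have := (hT.comp hL).mul hQ
  rw [← mul_assoc, ← mul_assoc, hTS', one_mul] at this
  refine this.congr fun i => ?_
  rw [hfac]
  rfl

/-- Powers of `1 + h • J` when `J * J = -1`. -/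
theorem one_add_smul_pow_of_mul_self_eq_neg_one {R : Type*} [Ring R] [Algebra ℂ R] {J : R}
    (hJ : J * J = -1) (h : ℂ) (n : ℕ) :
    (1 + h • J) ^ n =
      (((1 + h * Complex.I) ^ n + (1 + -(h * Complex.I)) ^ n) / 2) • (1 : R) +
      (((1 + -(h * Complex.I)) ^ n - (1 + h * Complex.I) ^ n) * Complex.I / 2) • J := by
  induction n with
  | zero => simp
  | succ n ih =>
    rw [pow_succ, ih]
    set p := (1 + h * Complex.I) ^ n with hp
    set q := (1 + -(h * Complex.I)) ^ n with hq
    have : ∀ x y : ℂ, (x • (1 : R) + y • J) * (1 + h • J) =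
        (x - y * h) • (1 : R) + (y + x * h) • J := by
      intro x y
      simp only [mul_add, add_mul, mul_one, smul_mul_assoc, mul_smul_comm, one_mul, hJ, smul_neg]
      module
    rw [this, pow_succ, pow_succ, ← hp, ← hq]
    have hI := Complex.I_mul_I
    congr 2
    · ring
    · linear_combination ((p + q) * h / 2) * hI

/-- `J` plays the part of the imaginary unit, so the limit is the exponential of `w₀ • J`. The power
formula splits it into the two scalar limits for the eigenvalues `± I`. -/
theorem tendsto_one_add_smul_pow_of_mul_self_eq_neg_one {R : Type*} [NormedRing R]
    [NormedAlgebra ℂ R] {J : R} (hJ : J * J = -1) {ι : Type*} {l : Filter ι} (L : ι → ℕ)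
    (hL : Tendsto L l atTop) {w : ι → ℂ} {w₀ : ℂ} (hw : Tendsto w l (𝓝 w₀)) :
    Tendsto (fun i => (1 + (w i / L i) • J) ^ L i) l
      (𝓝 (Complex.cos w₀ • (1 : R) + Complex.sin w₀ • J)) := by
  have h1 := Complex.tendsto_one_add_div_pow L hL (hw.mul_const Complex.I)
  have h2 := Complex.tendsto_one_add_div_pow L hL (hw.mul_const Complex.I).neg
  have h3 := (((h1.add h2).div_const 2).smul_const (1 : R)).add
    ((((h2.sub h1).mul_const Complex.I).div_const 2).smul_const J)
  rw [Complex.cos, Complex.sin, neg_mul]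
  refine h3.congr fun i => ?_
  rw [one_add_smul_pow_of_mul_self_eq_neg_one hJ]
  simp only [div_mul_eq_mul_div, neg_div]

/-! ### Transfer matrices in the free basis -/

/-- In coordinates relative to `cos (n θ)`, `sin (n θ)`, a potential `w` at site `n + 1` acts on
solutions of the difference equation as `1 + w • siteMat θ n`. -/
noncomputable def siteMat (θ : ℝ) (n : ℕ) : Matrix (Fin 2) (Fin 2) ℝ :=
  (Real.sin θ)⁻¹ •
    !![-(Real.sin ((n + 1) * θ) * Real.cos ((n + 1) * θ)),
        -(Real.sin ((n + 1) * θ) * Real.sin ((n + 1) * θ));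
      Real.cos ((n + 1) * θ) * Real.cos ((n + 1) * θ),
        Real.sin ((n + 1) * θ) * Real.cos ((n + 1) * θ)]

/-- The product of the transfer matrices of the potential `b` over the first `n` sites. -/
noncomputable def transferMat (θ : ℝ) (b : ℕ → ℝ) (n : ℕ) : Matrix (Fin 2) (Fin 2) ℝ :=
  orderedProd (fun j => 1 - b j • siteMat θ j) n

/-- `siteMat` has trace and determinant zero. As a consequence the adjugate serves as inverse of
every transfer matrix and of their limit. -/
theorem det_one_sub_smul_siteMat (θ x : ℝ) (n : ℕ) : (1 - x • siteMat θ n).det = 1 := by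
  simp only [siteMat, Matrix.det_fin_two, Matrix.sub_apply, Matrix.smul_apply, Matrix.one_apply]
  simp
  ring

theorem det_transferMat (θ : ℝ) (b : ℕ → ℝ) (n : ℕ) : (transferMat θ b n).det = 1 := by
  induction n with
  | zero => simp [transferMat, orderedProd]
  | succ n ih =>
    have : transferMat θ b (n + 1) = (1 - b n • siteMat θ n) * transferMat θ b n := rfl
    rw [this, Matrix.det_mul, det_one_sub_smul_siteMat, ih, one_mul]

theorem orderedProd_map {R S : Type*} [Semiring R] [Semiring S] (f : R →+* S) (A : ℕ → R) (n : ℕ) :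
    f (orderedProd A n) = orderedProd (fun j => f (A j)) n := by
  induction n with
  | zero => simp [orderedProd]
  | succ n ih => simp [orderedProd, ih]

/-- Consecutive values `(D n, D (n - 1))` of the three-term recursion
`D (n + 1) = (E - b n) * D n - D (n - 1)`, `D 0 = 1`, `D (-1) = 0`. -/
def charPair {R : Type*} [CommRing R] (b : ℕ → R) (E : R) : ℕ → R × R
  | 0 => (1, 0)
  | n + 1 => ((E - b n) * (charPair b E n).1 - (charPair b E n).2, (charPair b E n).1)

/-- The solution of `D (n + 1) = (E - b n) * D n - D (n - 1)`, `D 0 = 1`, `D (-1) = 0`. -/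
def charSeq {R : Type*} [CommRing R] (b : ℕ → R) (E : R) (n : ℕ) : R := (charPair b E n).1

/-- The complexified `siteMat`. -/
noncomputable def siteMatC (θ : ℝ) (n : ℕ) : Matrix (Fin 2) (Fin 2) ℂ :=
  Complex.ofRealHom.mapMatrix (siteMat θ n)

/-- The second column of `P` holds the coefficients of the solution with respect to `cos`, `sin`; it
starts at `(0, 1)`, that is at `sin (n θ)`, which vanishes at site 0. The factor of a site changes
the coefficients in a direction orthogonal to `(cos, sin)` there, so the value at that site is kept
and only the next one feels the potential. -/
theorem charPair_eq_orderedProd {θ : ℝ} (hθ : Real.sin θ ≠ 0) (b : ℕ → ℝ) (h : ℂ) (n : ℕ) :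
    let P := orderedProd (fun j => Complex.ofRealHom.mapMatrix (1 - b j • siteMat θ j) +
      h • siteMatC θ j) n
    P 0 1 * Real.cos ((n + 1) * θ) + P 1 1 * Real.sin ((n + 1) * θ) =
      Real.sin θ * (charPair (fun j => (b j : ℂ)) (2 * Real.cos θ + h) n).1 ∧
    P 0 1 * Real.cos (n * θ) + P 1 1 * Real.sin (n * θ) =
      Real.sin θ * (charPair (fun j => (b j : ℂ)) (2 * Real.cos θ + h) n).2 := by
  induction n with
  | zero => simp [orderedProd, charPair]
  | succ n ih =>
    obtain ⟨ih1, ih2⟩ := ih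
    have hs : (Real.sin θ : ℂ) ≠ 0 := by exact_mod_cast hθ
    simp only [orderedProd]
    set P := orderedProd (fun j => Complex.ofRealHom.mapMatrix (1 - b j • siteMat θ j) +
      h • siteMatC θ j) n with hP
    have hc2 : Real.cos ((((n + 1 : ℕ) : ℝ) + 1) * θ) =
        2 * Real.cos θ * Real.cos ((n + 1) * θ) - Real.cos (n * θ) := by
      have e1 : (((n + 1 : ℕ) : ℝ) + 1) * θ = (n + 1) * θ + θ := by push_cast; ring
      have e2 : (n : ℝ) * θ = (n + 1) * θ - θ := by ring
      rw [e1, e2, Real.cos_add, Real.cos_sub]; ring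
    have hs2 : Real.sin ((((n + 1 : ℕ) : ℝ) + 1) * θ) =
        2 * Real.cos θ * Real.sin ((n + 1) * θ) - Real.sin (n * θ) := by
      have e1 : (((n + 1 : ℕ) : ℝ) + 1) * θ = (n + 1) * θ + θ := by push_cast; ring
      have e2 : (n : ℝ) * θ = (n + 1) * θ - θ := by ring
      rw [e1, e2, Real.sin_add, Real.sin_sub]; ring
    have hcn : Real.cos (n * θ) =
        Real.cos ((n + 1) * θ) * Real.cos θ + Real.sin ((n + 1) * θ) * Real.sin θ := by
      rw [← Real.cos_sub]; congr 1; ring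
    have hsn : Real.sin (n * θ) =
        Real.sin ((n + 1) * θ) * Real.cos θ - Real.cos ((n + 1) * θ) * Real.sin θ := by
      rw [← Real.sin_sub]; congr 1; ring
    have hone := Real.sin_sq_add_cos_sq (((n : ℝ) + 1) * θ)
    have hone' : (Real.sin (((n : ℝ) + 1) * θ) : ℂ) ^ 2 + (Real.cos (((n : ℝ) + 1) * θ) : ℂ) ^ 2
        = 1 := by exact_mod_cast hone
    rw [hc2, hs2]
    have hn1 : (((n + 1 : ℕ) : ℝ)) = (n : ℝ) + 1 := by push_cast; ring
    rw [hn1]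
    rw [hcn, hsn] at ih2
    rw [hcn, hsn]
    set s := Real.sin (((n : ℝ) + 1) * θ) with hsd
    set c := Real.cos (((n : ℝ) + 1) * θ) with hcd
    set p := P 0 1 with hp
    set q := P 1 1 with hq
    have e0 : ((Complex.ofRealHom.mapMatrix (1 - b n • siteMat θ n) + h • siteMatC θ n) * P :
        Matrix (Fin 2) (Fin 2) ℂ) 0 1 =
        p - (h - b n) * (Real.sin θ : ℂ)⁻¹ * s * (p * c + q * s) := by
      simp [siteMatC, siteMat, Matrix.mul_apply, Fin.sum_univ_two, ← hsd, ← hcd, ← hp, ← hq]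
      ring
    have e1 : ((Complex.ofRealHom.mapMatrix (1 - b n • siteMat θ n) + h • siteMatC θ n) * P :
        Matrix (Fin 2) (Fin 2) ℂ) 1 1 =
        q + (h - b n) * (Real.sin θ : ℂ)⁻¹ * c * (p * c + q * s) := by
      simp [siteMatC, siteMat, Matrix.mul_apply, Fin.sum_univ_two, ← hsd, ← hcd, ← hp, ← hq]
      ring
    rw [e0, e1]
    simp only [charPair]
    set D := (charPair (fun j => (b j : ℂ)) (2 * Real.cos θ + h) n).1
    set D' := (charPair (fun j => (b j : ℂ)) (2 * Real.cos θ + h) n).2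
    set S : ℂ := (Real.sin θ : ℂ) with hS
    have hSi : S⁻¹ * S = 1 := inv_mul_cancel₀ hs
    simp only [Complex.ofReal_mul, Complex.ofReal_add, Complex.ofReal_sub,
      Complex.ofReal_ofNat] at ih1 ih2 ⊢
    rw [← hS] at ih2 ⊢
    rw [ih1]
    constructor
    · linear_combination 2 * (Real.cos θ : ℂ) * ih1 - ih2 + (h - b n) * S * D * hSi * (s ^ 2 + c ^ 2)
        + (h - b n) * S * D * hone'
    · linear_combination ih1

/-! ### Averaging of the site matrices and scaling limit of the solutions -/

/-- Real and imaginary parts of a geometric sum with ratio `exp (2 i θ)`, which differs from 1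
exactly because `sin θ ≠ 0`. -/
theorem exists_norm_sum_cos_sin_le {θ : ℝ} (hθ : Real.sin θ ≠ 0) :
    ∃ C : ℝ, ∀ n : ℕ, |∑ j ∈ Finset.range n, Real.cos (2 * ((j + 1) * θ))| ≤ C ∧
      |∑ j ∈ Finset.range n, Real.sin (2 * ((j + 1) * θ))| ≤ C := by
  set r : ℂ := Complex.exp ((2 * θ : ℝ) * Complex.I) with hr
  have hnorm : ‖r‖ = 1 := Complex.norm_exp_ofReal_mul_I _
  have hr1 : r ≠ 1 := by
    intro h
    have h1 : r.re = 1 := by rw [h]; simp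
    rw [hr, Complex.exp_ofReal_mul_I_re, Real.cos_two_mul] at h1
    have := Real.sin_sq_add_cos_sq θ
    exact hθ (pow_eq_zero_iff (two_ne_zero) |>.1 (by linarith))
  have hpow : ∀ j : ℕ, r ^ (j + 1) = Complex.exp ((2 * ((j + 1) * θ) : ℝ) * Complex.I) := by
    intro j
    rw [hr, ← Complex.exp_nat_mul]
    congr 1
    push_cast; ring
  refine ⟨2 / ‖r - 1‖, fun n => ?_⟩
  have hsum : ‖∑ j ∈ Finset.range n, r ^ (j + 1)‖ ≤ 2 / ‖r - 1‖ := by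
    have : ∑ j ∈ Finset.range n, r ^ (j + 1) = r * ((r ^ n - 1) / (r - 1)) := by
      rw [← geom_sum_eq hr1, Finset.mul_sum]
      exact Finset.sum_congr rfl fun j _ => pow_succ' r j
    rw [this, norm_mul, hnorm, one_mul, norm_div]
    gcongr
    refine (norm_sub_le _ _).trans ?_
    rw [norm_pow, hnorm]; norm_num
  have hre : (∑ j ∈ Finset.range n, r ^ (j + 1)).re =
      ∑ j ∈ Finset.range n, Real.cos (2 * ((j + 1) * θ)) := by
    rw [Complex.re_sum]
    refine Finset.sum_congr rfl fun j _ => ?_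
    rw [hpow, Complex.exp_ofReal_mul_I_re]
  have him : (∑ j ∈ Finset.range n, r ^ (j + 1)).im =
      ∑ j ∈ Finset.range n, Real.sin (2 * ((j + 1) * θ)) := by
    rw [Complex.im_sum]
    refine Finset.sum_congr rfl fun j _ => ?_
    rw [hpow, Complex.exp_ofReal_mul_I_im]
  rw [← hre, ← him]
  exact ⟨(Complex.abs_re_le_norm _).trans hsum, (Complex.abs_im_le_norm _).trans hsum⟩

/-- Double-angle formulas separate the mean, a multiple of the rotation generator, from the part
oscillating with frequency `2 θ`. -/
theorem siteMatC_eq (θ : ℝ) (j : ℕ) :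
    siteMatC θ j = ((2 * Real.sin θ)⁻¹ : ℂ) • (!![0, -1; 1, 0] : Matrix (Fin 2) (Fin 2) ℂ) +
      (((2 * Real.sin θ)⁻¹ : ℂ) * (Real.cos (2 * ((j + 1) * θ)) : ℂ)) • !![0, 1; 1, 0] +
      (((2 * Real.sin θ)⁻¹ : ℂ) * (Real.sin (2 * ((j + 1) * θ)) : ℂ)) • !![-1, 0; 0, 1] := by
  rw [Real.sin_two_mul, Real.cos_two_mul]
  have hone := Real.sin_sq_add_cos_sq (((j : ℝ) + 1) * θ)
  have hone' : (Real.sin (((j : ℝ) + 1) * θ) : ℂ) ^ 2 + (Real.cos (((j : ℝ) + 1) * θ) : ℂ) ^ 2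
      = 1 := by exact_mod_cast hone
  push_cast at hone'
  ext i k
  fin_cases i <;> fin_cases k <;> simp [siteMatC, siteMat]
  · ring
  · linear_combination (-(Complex.sin θ)⁻¹) * hone'
  · ring
  · ring

section Limit

attribute [local instance] Matrix.linftyOpNormedRing Matrix.linftyOpNormedAlgebra
  Matrix.linfty_opNormOneClass

theorem exists_norm_siteMatC_le (θ : ℝ) : ∃ K : ℝ, ∀ j, ‖siteMatC θ j‖ ≤ K := by
  refine ⟨‖((2 * Real.sin θ)⁻¹ : ℂ)‖ * ‖(!![0, -1; 1, 0] : Matrix (Fin 2) (Fin 2) ℂ)‖ +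
    ‖((2 * Real.sin θ)⁻¹ : ℂ)‖ * ‖(!![0, 1; 1, 0] : Matrix (Fin 2) (Fin 2) ℂ)‖ +
    ‖((2 * Real.sin θ)⁻¹ : ℂ)‖ * ‖(!![-1, 0; 0, 1] : Matrix (Fin 2) (Fin 2) ℂ)‖, fun j => ?_⟩
  rw [siteMatC_eq]
  have hb : ∀ x : ℝ, |x| ≤ 1 → ‖((2 * Real.sin θ)⁻¹ : ℂ) * (x : ℂ)‖ ≤
      ‖((2 * Real.sin θ)⁻¹ : ℂ)‖ := by
    intro x hx
    rw [norm_mul, Complex.norm_real, Real.norm_eq_abs]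
    exact mul_le_of_le_one_right (norm_nonneg _) hx
  refine (norm_add_le _ _).trans (add_le_add ((norm_add_le _ _).trans (add_le_add ?_ ?_)) ?_)
  · exact (norm_smul _ _).le
  · rw [norm_smul]
    gcongr
    exact hb _ (Real.abs_cos_le_one _)
  · rw [norm_smul]
    gcongr
    exact hb _ (Real.abs_sin_le_one _)

theorem exists_norm_sum_siteMatC_sub_le {θ : ℝ} (hθ : Real.sin θ ≠ 0) :
    ∃ C : ℝ, ∀ n, ‖∑ j ∈ Finset.range n, (siteMatC θ j -
      ((2 * Real.sin θ)⁻¹ : ℂ) • (!![0, -1; 1, 0] : Matrix (Fin 2) (Fin 2) ℂ))‖ ≤ C := by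
  obtain ⟨C, hC⟩ := exists_norm_sum_cos_sin_le hθ
  refine ⟨‖((2 * Real.sin θ)⁻¹ : ℂ)‖ * C * ‖(!![0, 1; 1, 0] : Matrix (Fin 2) (Fin 2) ℂ)‖ +
    ‖((2 * Real.sin θ)⁻¹ : ℂ)‖ * C * ‖(!![-1, 0; 0, 1] : Matrix (Fin 2) (Fin 2) ℂ)‖, fun n => ?_⟩
  have e : ∑ j ∈ Finset.range n, (siteMatC θ j -
      ((2 * Real.sin θ)⁻¹ : ℂ) • (!![0, -1; 1, 0] : Matrix (Fin 2) (Fin 2) ℂ)) =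
      (((2 * Real.sin θ)⁻¹ : ℂ) *
        ((∑ j ∈ Finset.range n, Real.cos (2 * ((j + 1) * θ)) : ℝ) : ℂ)) • !![0, 1; 1, 0] +
      (((2 * Real.sin θ)⁻¹ : ℂ) *
        ((∑ j ∈ Finset.range n, Real.sin (2 * ((j + 1) * θ)) : ℝ) : ℂ)) • !![-1, 0; 0, 1] := by
    rw [Complex.ofReal_sum, Complex.ofReal_sum, Finset.mul_sum, Finset.mul_sum, Finset.sum_smul,
      Finset.sum_smul, ← Finset.sum_add_distrib]
    refine Finset.sum_congr rfl fun j _ => ?_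
    rw [siteMatC_eq]
    abel
  rw [e]
  refine (norm_add_le _ _).trans (add_le_add ?_ ?_)
  · rw [norm_smul, norm_mul, Complex.norm_real, Real.norm_eq_abs]
    gcongr
    exact (hC n).1
  · rw [norm_smul, norm_mul, Complex.norm_real, Real.norm_eq_abs]
    gcongr
    exact (hC n).2

/-- If the transfer matrices converge, the rescaled solutions converge to trigonometric
functions. -/
theorem tendsto_charSeq {θ : ℝ} (hθ : Real.sin θ ≠ 0) {b : ℕ → ℝ}
    {T : Matrix (Fin 2) (Fin 2) ℝ} (hT : Tendsto (transferMat θ b) atTop (𝓝 T))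
    {ι : Type*} {l : Filter ι} (L : ι → ℕ) (hL : Tendsto L l atTop) {z : ι → ℂ} {z₀ : ℂ}
    (hz : Tendsto z l (𝓝 z₀)) {φ : ℝ}
    (hc : Tendsto (fun i => Real.cos ((L i + 1) * θ)) l (𝓝 (Real.cos φ)))
    (hs : Tendsto (fun i => Real.sin ((L i + 1) * θ)) l (𝓝 (Real.sin φ))) :
    Tendsto (fun i => charSeq (fun j => (b j : ℂ)) (2 * Real.cos θ + z i / L i) (L i)) l
      (𝓝 ((Real.sin θ : ℂ)⁻¹ * (T 0 1 * Complex.cos (z₀ * ((2 * Real.sin θ)⁻¹ : ℂ) - φ) -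
        T 1 1 * Complex.sin (z₀ * ((2 * Real.sin θ)⁻¹ : ℂ) - φ)))) := by
  obtain ⟨K, hK⟩ := exists_norm_siteMatC_le θ
  obtain ⟨C, hC⟩ := exists_norm_sum_siteMatC_sub_le hθ
  set J : Matrix (Fin 2) (Fin 2) ℂ := !![0, -1; 1, 0] with hJd
  have hJ : J * J = -1 := by
    ext i k
    fin_cases i <;> fin_cases k <;> simp [hJd, Matrix.mul_apply, Fin.sum_univ_two]
  set κ : ℂ := ((2 * Real.sin θ)⁻¹ : ℂ) with hκ
  have hcont : Continuous fun X : Matrix (Fin 2) (Fin 2) ℝ => Complex.ofRealHom.mapMatrix X :=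
    Continuous.matrix_map continuous_id Complex.continuous_ofReal
  have hTdet : T.det = 1 := by
    have h1 := (Continuous.matrix_det continuous_id).continuousAt.tendsto.comp hT
    refine tendsto_nhds_unique h1 ?_
    simp [Function.comp_def, det_transferMat]
  have hadj : ∀ X : Matrix (Fin 2) (Fin 2) ℝ, X.det = 1 →
      Complex.ofRealHom.mapMatrix X * Complex.ofRealHom.mapMatrix X.adjugate = 1 ∧
      Complex.ofRealHom.mapMatrix X.adjugate * Complex.ofRealHom.mapMatrix X = 1 := by
    intro X hX
    rw [← map_mul, ← map_mul, Matrix.mul_adjugate, Matrix.adjugate_mul, hX, one_smul, map_one]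
    exact ⟨rfl, rfl⟩
  have hprod : orderedProd (fun j => Complex.ofRealHom.mapMatrix (1 - b j • siteMat θ j)) =
      fun n => Complex.ofRealHom.mapMatrix (transferMat θ b n) := by
    funext n
    rw [transferMat, orderedProd_map]
  have hW := tendsto_one_add_smul_pow_of_mul_self_eq_neg_one hJ L hL (hz.mul_const κ)
  have hmain := tendsto_orderedProd_add_smul L hL hz
    (A := fun j => Complex.ofRealHom.mapMatrix (1 - b j • siteMat θ j)) (M := siteMatC θ)
    (S := fun n => Complex.ofRealHom.mapMatrix (transferMat θ b n).adjugate)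
    (N := κ • J) (T' := Complex.ofRealHom.mapMatrix T)
    (S' := Complex.ofRealHom.mapMatrix T.adjugate)
    (W := Complex.cos (z₀ * κ) • 1 + Complex.sin (z₀ * κ) • J)
    hK hC (fun j => by rw [hprod]; exact (hadj _ (det_transferMat θ b j)).1)
    (by rw [hprod]; exact hcont.continuousAt.tendsto.comp hT)
    ((hcont.comp (Continuous.matrix_adjugate continuous_id)).continuousAt.tendsto.comp hT)
    (hadj T hTdet).1 (hadj T hTdet).2
    (hW.congr fun i => by rw [smul_smul, div_mul_eq_mul_div])
  have hentry : ∀ i k, Continuous fun X : Matrix (Fin 2) (Fin 2) ℂ => X i k := fun i k =>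
    continuous_id.matrix_elem i k
  have h0 := (hentry 0 1).continuousAt.tendsto.comp hmain
  have h1 := (hentry 1 1).continuousAt.tendsto.comp hmain
  have hc' := (Complex.continuous_ofReal.continuousAt.tendsto.comp hc)
  have hs' := (Complex.continuous_ofReal.continuousAt.tendsto.comp hs)
  have hfin := ((h0.mul hc').add (h1.mul hs')).const_mul ((Real.sin θ : ℂ)⁻¹)
  have hsne : (Real.sin θ : ℂ) ≠ 0 := by exact_mod_cast hθ
  -- Pairing the rotated second column of `T` with `(cos φ, sin φ)` shifts the rotation angle by
  -- `-φ`.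
  have hlimit : (Real.sin θ : ℂ)⁻¹ * (T 0 1 * Complex.cos (z₀ * κ - φ) -
        T 1 1 * Complex.sin (z₀ * κ - φ)) = (Real.sin θ : ℂ)⁻¹ *
      (((Complex.cos (z₀ * κ) • 1 + Complex.sin (z₀ * κ) • J) *
          Complex.ofRealHom.mapMatrix T : Matrix (Fin 2) (Fin 2) ℂ) 0 1 * (Real.cos φ : ℂ) +
        ((Complex.cos (z₀ * κ) • 1 + Complex.sin (z₀ * κ) • J) *
          Complex.ofRealHom.mapMatrix T : Matrix (Fin 2) (Fin 2) ℂ) 1 1 * (Real.sin φ : ℂ)) := by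
    rw [Complex.cos_sub, Complex.sin_sub]
    simp [hJd, Matrix.mul_apply, Fin.sum_univ_two]
    left
    ring
  rw [hlimit]
  refine hfin.congr fun i => ?_
  have := (charPair_eq_orderedProd hθ b (z i / L i) (L i)).1
  simp only [Function.comp_apply]
  rw [this, ← mul_assoc, inv_mul_cancel₀ hsne, one_mul]
  rfl

end Limit

/-! ### The characteristic polynomial of the box operator -/

/-- The matrix `E - H_n` for the tridiagonal matrix `H_n` with diagonal `b`. -/
def triMat {R : Type*} [CommRing R] (b : ℕ → R) (E : R) (n : ℕ) : Matrix (Fin n) (Fin n) R :=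
  Matrix.of fun i j => (if i = j then E - b i else 0) - (if (i : ℕ) + 1 = j then 1 else 0) -
    (if (j : ℕ) + 1 = i then 1 else 0)

theorem triMat_submatrix_castSucc {R : Type*} [CommRing R] (b : ℕ → R) (E : R) (n : ℕ) :
    (triMat b E (n + 1)).submatrix Fin.castSucc Fin.castSucc = triMat b E n := by
  ext i j
  simp [triMat, Fin.ext_iff]

/-- Laplace expansion along the last row, which has two nonzero entries; the off-diagonal minor is
expanded once more along its last column. -/
theorem det_triMat_succ_succ {R : Type*} [CommRing R] (b : ℕ → R) (E : R) (n : ℕ) :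
    (triMat b E (n + 2)).det =
      (E - b (n + 1)) * (triMat b E (n + 1)).det - (triMat b E n).det := by
  rw [Matrix.det_succ_row _ (Fin.last (n + 1)), Fin.sum_univ_castSucc, Fin.sum_univ_castSucc]
  have hzero : ∀ i : Fin n, triMat b E (n + 2) (Fin.last (n + 1)) i.castSucc.castSucc = 0 := by
    intro i
    have h1 : n + 1 ≠ (i : ℕ) := by omega
    have h2 : n + 1 + 1 ≠ (i : ℕ) := by omega
    have h3 : (i : ℕ) ≠ n := by omega
    simp [triMat, Fin.ext_iff, h1, h2, h3]
  have hlast : triMat b E (n + 2) (Fin.last (n + 1)) (Fin.last (n + 1)) = E - b (n + 1) := by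
    simp [triMat]
  have hprev : triMat b E (n + 2) (Fin.last (n + 1)) (Fin.last n).castSucc = -1 := by
    simp [triMat, Fin.ext_iff]
    omega
  have hminor : ((triMat b E (n + 2)).submatrix (Fin.last (n + 1)).succAbove
      (Fin.last n).castSucc.succAbove).det = -(triMat b E n).det := by
    rw [Matrix.det_succ_column _ (Fin.last n), Fin.sum_univ_castSucc]
    have hz : ∀ i : Fin n, (triMat b E (n + 2)).submatrix (Fin.last (n + 1)).succAbove
        (Fin.last n).castSucc.succAbove i.castSucc (Fin.last n) = 0 := by
      intro i
      have h1 : (i : ℕ) ≠ n + 1 := by omega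
      have h2 : (i : ℕ) ≠ n := by omega
      have h3 : n + 1 + 1 ≠ (i : ℕ) := by omega
      simp [triMat, Fin.ext_iff, h1, h2, h3]
    have hl : (triMat b E (n + 2)).submatrix (Fin.last (n + 1)).succAbove
        (Fin.last n).castSucc.succAbove (Fin.last n) (Fin.last n) = -1 := by
      simp [triMat, Fin.ext_iff]
      omega
    have hsub : ((triMat b E (n + 2)).submatrix (Fin.last (n + 1)).succAbove
        (Fin.last n).castSucc.succAbove).submatrix (Fin.last n).succAbove (Fin.last n).succAbove =
        triMat b E n := by
      rw [Fin.succAbove_last, Fin.succAbove_last, ← triMat_submatrix_castSucc b E n,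
        ← triMat_submatrix_castSucc b E (n + 1)]
      ext i j
      have hj : (Fin.last n).castSucc.succAbove j.castSucc = j.castSucc.castSucc := by
        apply Fin.succAbove_of_castSucc_lt
        simp [Fin.lt_def]
      simp [hj]
    simp only [hz, hl, hsub]
    simp
  have hlastminor : (triMat b E (n + 2)).submatrix (Fin.last (n + 1)).succAbove
      (Fin.last (n + 1)).succAbove = triMat b E (n + 1) := by
    rw [Fin.succAbove_last, triMat_submatrix_castSucc]
  simp only [hzero, hlast, hprev, hminor, hlastminor]
  simp
  ring

theorem det_triMat {R : Type*} [CommRing R] (b : ℕ → R) (E : R) (n : ℕ) :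
    (triMat b E n).det = charSeq b E n := by
  induction n using Nat.twoStepInduction with
  | zero => simp [charSeq, charPair]
  | one => simp [charSeq, charPair, triMat]
  | more n ih1 ih2 =>
    rw [det_triMat_succ_succ, ih1, ih2]
    rfl

theorem charpoly_rescaledBoxOp_eval (a w : ℕ → ℝ) (E₀ : ℝ) {L : ℕ} (hL : L ≠ 0) (z : ℂ) :
    (rescaledBoxOp a w E₀ L).charpoly.eval z =
      (L : ℂ) ^ L * charSeq (fun j => ((a j * w j : ℝ) : ℂ)) (E₀ + z / L) L := by
  have hL' : (L : ℂ) ≠ 0 := by exact_mod_cast hL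
  rw [Matrix.eval_charpoly, ← det_triMat]
  have : Matrix.scalar (Fin L) z - rescaledBoxOp a w E₀ L =
      (L : ℂ) • triMat (fun j => ((a j * w j : ℝ) : ℂ)) (E₀ + z / L) L := by
    ext i j
    simp only [rescaledBoxOp, Matrix.sub_apply, Matrix.smul_apply, boxOp_apply, triMat,
      Matrix.of_apply, Matrix.one_apply, smul_eq_mul, Matrix.scalar_apply, Matrix.diagonal_apply]
    by_cases h : i = j
    · subst h
      simp
      field_simp
      ring
    · simp only [h, if_false]
      ring
  rw [this, Matrix.det_smul, Fintype.card_fin]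

/-- The bridge between the recursion, whose asymptotics are known, and the points of the eigenvalue
process. -/
theorem charSeq_eq_prod_eigenvalues (a w : ℕ → ℝ) (E₀ : ℝ) {L : ℕ} (hL : L ≠ 0) (z : ℂ) :
    charSeq (fun j => ((a j * w j : ℝ) : ℂ)) (E₀ + z / L) L = (((L : ℝ) ^ L)⁻¹ : ℝ) *
      ∏ i, (z - ((rescaledBoxOp_isHermitian a w E₀ L).eigenvalues i : ℂ)) := by
  have hL' : (L : ℂ) ≠ 0 := by exact_mod_cast hL
  have h := charpoly_rescaledBoxOp_eval a w E₀ hL z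
  rw [(rescaledBoxOp_isHermitian a w E₀ L).charpoly_eq, Polynomial.eval_prod] at h
  simp only [Polynomial.eval_sub, Polynomial.eval_X, Polynomial.eval_C] at h
  rw [Complex.ofReal_inv, Complex.ofReal_pow, Complex.ofReal_natCast]
  rw [eq_inv_mul_iff_mul_eq₀ (pow_ne_zero _ hL')]
  exact h.symm

/-! ### Convergence of zeros and vague convergence -/

/-- Each term of the product rule omits one factor and so retains one of the two vanishing ones.
This excludes two eigenvalues at the same place wherever the derivative is positive. -/
theorem hasDerivAt_const_mul_prod_sub_of_double_root {n : ℕ} (c : ℝ) (v : Fin n → ℝ) {x : ℝ}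
    {i j : Fin n} (hij : i ≠ j) (hi : v i = x) (hj : v j = x) :
    HasDerivAt (fun y => c * ∏ i, (y - v i)) 0 x := by
  have h := (HasDerivAt.fun_finsetProd (u := Finset.univ) (f := fun m (y : ℝ) => y - v m)
    (f' := fun _ => (1 : ℝ)) (x := x) fun m _ => (hasDerivAt_id x).sub_const (v m)).const_mul c
  refine h.congr_deriv ?_
  rw [Finset.sum_eq_zero, mul_zero]
  intro m _
  have hz : ∏ l ∈ Finset.univ.erase m, (x - v l) = 0 := by
    by_cases him : i = m
    · exact Finset.prod_eq_zero (i := j) (Finset.mem_erase.2 ⟨fun e => hij (him.trans e.symm),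
        Finset.mem_univ _⟩) (by rw [hj, sub_self])
    · exact Finset.prod_eq_zero (i := i) (Finset.mem_erase.2 ⟨him, Finset.mem_univ _⟩)
        (by rw [hi, sub_self])
  rw [hz, zero_smul]

/-- Near a simple zero of the limit function, exactly one root contributes. -/
theorem tendsto_sum_of_simple_zero {n : ℕ → ℕ} {v : ∀ k, Fin (n k) → ℝ} {c : ℕ → ℝ}
    {f : ℕ → ℝ → ℝ} (hf : ∀ᶠ k in atTop, c k ≠ 0 ∧ f k = fun x => c k * ∏ i, (x - v k i))
    {x₀ r : ℝ} (hr : 0 < r)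
    (hderiv : ∀ᶠ k in atTop, ∀ y ∈ Metric.ball x₀ r, 0 < deriv (f k) y)
    (hneg : ∀ y ∈ Metric.ball x₀ r, y < x₀ → ∀ᶠ k in atTop, f k y < 0)
    (hpos : ∀ y ∈ Metric.ball x₀ r, x₀ < y → ∀ᶠ k in atTop, 0 < f k y)
    {φ : ℝ → ℝ} (hφ : Continuous φ) (hsupp : ∀ y ∉ Metric.ball x₀ r, φ y = 0) :
    Tendsto (fun k => ∑ i, φ (v k i)) atTop (𝓝 (φ x₀)) := by
  rw [Metric.tendsto_nhds]
  intro ε hε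
  obtain ⟨δ, hδ, hδφ⟩ := Metric.continuousAt_iff.1 hφ.continuousAt ε hε
  set ρ := min δ r / 2 with hρ
  have hρ0 : 0 < ρ := by positivity
  have hρδ : ρ < δ := by have := min_le_left δ r; linarith
  have hρr : ρ < r := by have := min_le_right δ r; linarith
  have hmem : ∀ y ∈ Icc (x₀ - ρ) (x₀ + ρ), dist y x₀ ≤ ρ := by
    intro y hy
    rw [Real.dist_eq, abs_le]
    constructor <;> linarith [hy.1, hy.2]
  filter_upwards [hf, hderiv,
    hneg (x₀ - ρ) ((hmem _ ⟨le_rfl, by linarith⟩).trans_lt hρr) (by linarith),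
    hpos (x₀ + ρ) ((hmem _ ⟨by linarith, le_rfl⟩).trans_lt hρr) (by linarith)]
    with k ⟨hc, hfk⟩ hd h1 h2
  have hcont : Continuous (f k) := by rw [hfk]; fun_prop
  obtain ⟨y, hy, hy0⟩ := intermediate_value_Icc (by linarith) hcont.continuousOn
    (show (0 : ℝ) ∈ Icc (f k (x₀ - ρ)) (f k (x₀ + ρ)) from ⟨h1.le, h2.le⟩)
  have hyr : y ∈ Metric.ball x₀ r := (hmem y hy).trans_lt hρr
  have hroot : ∃ i, v k i = y := by
    rw [hfk] at hy0
    obtain ⟨i, -, hi⟩ := Finset.prod_eq_zero_iff.1 ((mul_eq_zero.1 hy0).resolve_left hc)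
    exact ⟨i, by linarith⟩
  obtain ⟨i₀, hi₀⟩ := hroot
  have hmono : StrictMonoOn (f k) (Metric.ball x₀ r) :=
    strictMonoOn_of_deriv_pos (convex_ball _ _) hcont.continuousOn
      fun x hx => hd x (interior_subset hx)
  -- Strict monotonicity forces any other root in the ball to coincide with `y`, and a double root
  -- contradicts the positive derivative.
  have huniq : ∀ i, i ≠ i₀ → v k i ∉ Metric.ball x₀ r := by
    intro i hi hib
    have hz : f k (v k i) = 0 := by
      rw [hfk]
      simp only
      rw [Finset.prod_eq_zero (Finset.mem_univ i) (sub_self _), mul_zero]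
    have hey : v k i = y := hmono.injOn hib hyr (hz.trans hy0.symm)
    have := hasDerivAt_const_mul_prod_sub_of_double_root (c k) (v k) hi hey hi₀
    rw [← hfk] at this
    exact (hd y hyr).ne' this.deriv
  rw [Finset.sum_eq_single i₀ (fun i _ hi => hsupp _ (huniq i hi)) (by simp), hi₀]
  exact hδφ ((hmem y hy).trans_lt hρδ)

/-- Convergence of integrals against compactly supported continuous functions is local. -/
theorem tendsto_integral_of_local {m : ℕ → Measure ℝ} {m' : Measure ℝ}
    [∀ k, IsLocallyFiniteMeasure (m k)] [IsLocallyFiniteMeasure m']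
    (h : ∀ x : ℝ, ∃ U : Set ℝ, IsOpen U ∧ x ∈ U ∧ ∀ φ : ℝ → ℝ, Continuous φ → HasCompactSupport φ →
      (∀ y ∉ U, φ y = 0) → Tendsto (fun k => ∫ x, φ x ∂(m k)) atTop (𝓝 (∫ x, φ x ∂m')))
    {φ : ℝ → ℝ} (hφ : Continuous φ) (hcs : HasCompactSupport φ) :
    Tendsto (fun k => ∫ x, φ x ∂(m k)) atTop (𝓝 (∫ x, φ x ∂m')) := by
  choose U hUo hxU hU using h
  obtain ⟨s, -, hs⟩ := hcs.isCompact.elim_nhds_subcover U fun x _ => (hUo x).mem_nhds (hxU x)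
  let e := s.equivFin.symm
  obtain ⟨g, hgs, hg1, -, -⟩ := exists_continuous_sum_one_of_isOpen_isCompact
    (n := s.card) (t := tsupport φ) (s := fun i => U (e i)) (fun i => hUo _) hcs.isCompact (by
      intro x hx
      obtain ⟨y, hy, hxy⟩ := mem_iUnion₂.1 (hs hx)
      refine mem_iUnion.2 ⟨s.equivFin ⟨y, hy⟩, ?_⟩
      simpa [e] using hxy)
  have hsum : ∀ x, φ x = ∑ i, g i x * φ x := by
    intro x
    by_cases hx : x ∈ tsupport φ
    · have := hg1 hx
      rw [Finset.sum_apply, Pi.one_apply] at this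
      rw [← Finset.sum_mul, this, one_mul]
    · simp [image_eq_zero_of_notMem_tsupport hx]
  have hc : ∀ i, Continuous fun x => g i x * φ x := fun i => (g i).continuous.mul hφ
  have hk : ∀ i, HasCompactSupport fun x => g i x * φ x := fun i => hcs.mul_left
  have hint : ∀ (ν : Measure ℝ) [IsLocallyFiniteMeasure ν],
      ∫ x, φ x ∂ν = ∑ i, ∫ x, g i x * φ x ∂ν := by
    intro ν _
    rw [← integral_finsetSum _ fun i _ => (hc i).integrable_of_hasCompactSupport (hk i)]
    exact integral_congr_ae (Eventually.of_forall hsum)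
  simp only [hint]
  refine tendsto_finsetSum _ fun i _ => hU (e i) _ (hc i) (hk i) fun y hy => ?_
  rw [image_eq_zero_of_notMem_tsupport (fun hy' => hy (hgs i hy')), zero_mul]

theorem integral_sum_dirac {ι : Type*} (p : ι → ℝ)
    [IsLocallyFiniteMeasure (Measure.sum fun i => Measure.dirac (p i))]
    {φ : ℝ → ℝ} (hφ : Continuous φ) (hcs : HasCompactSupport φ) :
    HasSum (fun i => φ (p i)) (∫ x, φ x ∂(Measure.sum fun i => Measure.dirac (p i))) := by
  have := hasSum_integral_measure (hφ.integrable_of_hasCompactSupport hcs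
    (μ := Measure.sum fun i => Measure.dirac (p i)))
  simpa using this

/-- If polynomials with only real roots converge in `C¹` on compact sets to a function with simple
zeros, then the root-counting measures converge vaguely. -/
theorem tendsto_integral_of_roots {n : ℕ → ℕ} {v : ∀ k, Fin (n k) → ℝ} {c : ℕ → ℝ}
    {f : ℕ → ℝ → ℝ} (hf : ∀ᶠ k in atTop, c k ≠ 0 ∧ f k = fun x => c k * ∏ i, (x - v k i))
    {F : ℝ → ℝ} (hF : Continuous F) (hF' : Continuous (deriv F))
    (hlim : TendstoLocallyUniformly f F atTop)
    (hlim' : TendstoLocallyUniformly (fun k => deriv (f k)) (deriv F) atTop)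
    {p : ℤ → ℝ} (hinj : Function.Injective p) (hzero : ∀ x, F x = 0 ↔ ∃ j, p j = x)
    (hsimple : ∀ x, F x = 0 → deriv F x ≠ 0)
    [IsLocallyFiniteMeasure (Measure.sum fun j => Measure.dirac (p j))]
    [∀ k, IsLocallyFiniteMeasure (Measure.sum fun i => Measure.dirac (v k i))]
    {φ : ℝ → ℝ} (hφ : Continuous φ) (hcs : HasCompactSupport φ) :
    Tendsto (fun k => ∫ x, φ x ∂(Measure.sum fun i => Measure.dirac (v k i))) atTop
      (𝓝 (∫ x, φ x ∂(Measure.sum fun j => Measure.dirac (p j)))) := by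
  -- Positivity of the limit at one point spreads to a ball and, by local uniformity, to all late `g
  -- k` on that same ball.
  have hev : ∀ {g : ℕ → ℝ → ℝ} {G : ℝ → ℝ}, TendstoLocallyUniformly g G atTop → Continuous G →
      ∀ {x}, 0 < G x → ∃ r > 0, (∀ y ∈ Metric.ball x r, 0 < G y) ∧
        ∀ᶠ k in atTop, ∀ y ∈ Metric.ball x r, 0 < g k y := by
    intro g G hg hG x hx
    obtain ⟨t, ht, hgt⟩ := Metric.tendstoLocallyUniformly_iff.1 hg (G x / 2) (by positivity) x
    have hGx : ∀ᶠ y in 𝓝 x, G x / 2 < G y :=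
      hG.continuousAt.eventually (lt_mem_nhds (by linarith))
    obtain ⟨r, hr, hball⟩ := Metric.mem_nhds_iff.1 (inter_mem ht hGx)
    refine ⟨r, hr, fun y hy => ?_, ?_⟩
    · have : G x / 2 < G y := (hball hy).2
      linarith
    · filter_upwards [hgt] with k hk y hy
      have h1 : G x / 2 < G y := (hball hy).2
      have h2 := hk y (hball hy).1
      rw [Real.dist_eq, abs_lt] at h2
      linarith
  refine tendsto_integral_of_local (fun x => ?_) hφ hcs
  -- The factor `σ` is a sign, used with `± 1`, that makes the limit increasing through its zero.
  have hpos_case : ∀ {σ : ℝ}, σ ≠ 0 → F x = 0 → 0 < σ * deriv F x →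
      ∃ U : Set ℝ, IsOpen U ∧ x ∈ U ∧ ∀ φ : ℝ → ℝ, Continuous φ → HasCompactSupport φ →
      (∀ y ∉ U, φ y = 0) → Tendsto
        (fun k => ∫ x, φ x ∂(Measure.sum fun i => Measure.dirac (v k i))) atTop
        (𝓝 (∫ x, φ x ∂(Measure.sum fun j => Measure.dirac (p j)))) := by
    intro σ hσ hx0 hx'
    have hl : TendstoLocallyUniformly (fun k y => σ * deriv (f k) y) (fun y => σ * deriv F y)
        atTop := by
      have := (uniformContinuous_const_smul σ (X := ℝ)).comp_tendstoLocallyUniformly hlim'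
      exact this
    obtain ⟨r, hr, hFr, hfr⟩ := hev hl (continuous_const.mul hF') (x := x) hx'
    have hmono : StrictMonoOn (fun y => σ * F y) (Metric.ball x r) := by
      refine strictMonoOn_of_deriv_pos (convex_ball _ _) (continuous_const.mul hF).continuousOn
        fun y hy => ?_
      rw [deriv_const_mul_field']
      exact hFr y (interior_subset hy)
    have hxb : x ∈ Metric.ball x r := Metric.mem_ball_self hr
    have hpt : ∀ y, Tendsto (fun k => σ * f k y) atTop (𝓝 (σ * F y)) := fun y =>
      ((tendstoLocallyUniformlyOn_univ.2 hlim).tendsto_at (mem_univ y)).const_mul σ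
    refine ⟨Metric.ball x r, Metric.isOpen_ball, hxb, fun ψ hψ hψc hψs => ?_⟩
    have hmain := tendsto_sum_of_simple_zero (n := n) (v := v) (c := fun k => σ * c k)
      (f := fun k y => σ * f k y) (x₀ := x) (r := r) ?_ hr ?_ ?_ ?_ hψ hψs
    · have hkint : ∀ k, ∫ x, ψ x ∂(Measure.sum fun i => Measure.dirac (v k i)) =
          ∑ i, ψ (v k i) := fun k =>
        (integral_sum_dirac (v k) hψ hψc).unique (hasSum_fintype _)
      simp only [hkint]
      obtain ⟨j, hj⟩ := (hzero x).1 hx0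
      have hpint : ∫ x, ψ x ∂(Measure.sum fun j => Measure.dirac (p j)) = ψ x := by
        refine (integral_sum_dirac p hψ hψc).unique ?_
        rw [← hj]
        refine hasSum_single (f := fun i => ψ (p i)) j fun i hi => hψs _ fun hib => hi ?_
        have : F (p i) = 0 := (hzero _).2 ⟨i, rfl⟩
        have h1 : p i = x := hmono.injOn hib hxb (by simp [this, hx0])
        exact hinj (h1.trans hj.symm)
      rw [hpint]
      exact hmain
    · filter_upwards [hf] with k hk
      refine ⟨mul_ne_zero hσ hk.1, ?_⟩
      rw [hk.2]
      funext y
      ring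
    · filter_upwards [hfr] with k hk y hy
      rw [deriv_const_mul_field']
      exact hk y hy
    · intro y hy hyx
      have := hmono hy hxb hyx
      simp only [hx0, mul_zero] at this
      exact (hpt y).eventually (gt_mem_nhds this)
    · intro y hy hyx
      have := hmono hxb hy hyx
      simp only [hx0, mul_zero] at this
      exact (hpt y).eventually (lt_mem_nhds this)
  by_cases hx : F x = 0
  · rcases lt_or_gt_of_ne (hsimple x hx) with h | h
    · exact hpos_case (σ := -1) (by norm_num) hx (by linarith)
    · exact hpos_case (σ := 1) one_ne_zero hx (by linarith)
  -- Away from zeros, multiplying by `F x` makes the limit positive at `x`; then neither `F` nor a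
  -- late `f k` has a root nearby, and both integrals vanish.
  · have hl : TendstoLocallyUniformly (fun k y => F x * f k y) (fun y => F x * F y) atTop :=
      (uniformContinuous_const_smul (F x) (X := ℝ)).comp_tendstoLocallyUniformly hlim
    obtain ⟨r, hr, hFr, hfr⟩ := hev hl (continuous_const.mul hF) (x := x)
      (mul_self_pos.2 hx)
    refine ⟨Metric.ball x r, Metric.isOpen_ball, Metric.mem_ball_self hr,
      fun ψ hψ hψc hψs => ?_⟩
    have hpint : ∫ x, ψ x ∂(Measure.sum fun j => Measure.dirac (p j)) = 0 := by
      refine (integral_sum_dirac p hψ hψc).unique ?_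
      convert hasSum_zero with j
      refine hψs _ fun hj => ?_
      have := hFr _ hj
      rw [(hzero _).2 ⟨j, rfl⟩, mul_zero] at this
      exact lt_irrefl _ this
    rw [hpint]
    refine tendsto_const_nhds.congr' ?_
    filter_upwards [hf, hfr] with k hk hkr
    symm
    refine (integral_sum_dirac (v k) hψ hψc).unique ?_
    convert hasSum_zero with i
    refine hψs _ fun hi => ?_
    have := hkr _ hi
    rw [hk.2] at this
    have hz : ∏ j, (v k i - v k j) = 0 := Finset.prod_eq_zero (Finset.mem_univ i) (sub_self _)
    simp only [hz, mul_zero] at this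
    exact lt_irrefl _ this

/-! ### Convergence of the eigenvalue process for a fixed potential -/

theorem differentiable_charSeq (b : ℕ → ℂ) (E₀ c : ℂ) (n : ℕ) :
    Differentiable ℂ fun z => charSeq b (E₀ + z / c) n := by
  suffices h : (Differentiable ℂ fun z => (charPair b (E₀ + z / c) n).1) ∧
      Differentiable ℂ fun z => (charPair b (E₀ + z / c) n).2 from h.1
  induction n with
  | zero => exact ⟨differentiable_const _, differentiable_const _⟩
  | succ n ih =>
    refine ⟨?_, ih.1⟩
    have h1 := ih.1
    have h2 := ih.2
    simp only [charPair]
    fun_prop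

/-- The limiting phase, as a function of the limit of the transfer matrices. -/
noncomputable def limitPhase (T : Matrix (Fin 2) (Fin 2) ℝ) (φ : ℝ) : ℝ :=
  Complex.arg ⟨-T 1 1, T 0 1⟩ - φ

theorem LocFinMeasure.tendsto_iff {ι : Type*} {l : Filter ι} {m : ι → LocFinMeasure}
    {m' : LocFinMeasure} : Tendsto m l (𝓝 m') ↔
      ∀ f : C_c(ℝ, ℝ), Tendsto (fun i => ∫ x, f x ∂(m i).1) l (𝓝 (∫ x, f x ∂m'.1)) := by
  have : Topology.IsInducing
      (fun (m : LocFinMeasure) (f : C_c(ℝ, ℝ)) => ∫ x, f x ∂m.1) := ⟨rfl⟩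
  rw [this.tendsto_nhds_iff, tendsto_pi_nhds]
  rfl

/-- The deterministic core: once the transfer matrices and `(L k + 1) θ` modulo `2 π` converge, no
randomness is needed. -/
theorem tendsto_eigenvalueProcess {a w : ℕ → ℝ} {θ : ℝ} (hθ : θ ∈ Ioo 0 Real.pi)
    {T : Matrix (Fin 2) (Fin 2) ℝ}
    (hT : Tendsto (transferMat θ fun j => a j * w j) atTop (𝓝 T)) {L : ℕ → ℕ}
    (hL : Tendsto L atTop atTop) {φ : ℝ}
    (hc : Tendsto (fun k => Real.cos ((L k + 1) * θ)) atTop (𝓝 (Real.cos φ)))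
    (hs : Tendsto (fun k => Real.sin ((L k + 1) * θ)) atTop (𝓝 (Real.sin φ))) :
    Tendsto (fun k => eigenvalueProcess a w (2 * Real.cos θ) (L k)) atTop
      (𝓝 (clockMeasure θ hθ (limitPhase T φ))) := by
  have hsθ : 0 < Real.sin θ := Real.sin_pos_of_mem_Ioo hθ
  set Z : ℂ := ⟨-T 1 1, T 0 1⟩ with hZ
  set g : ℝ := limitPhase T φ with hg
  set κ : ℝ := (2 * Real.sin θ)⁻¹ with hκ
  have hκ0 : κ ≠ 0 := by positivity
  have hdet : T.det = 1 := by
    have h1 := (Continuous.matrix_det continuous_id).continuousAt.tendsto.comp hT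
    refine tendsto_nhds_unique h1 ?_
    simp [Function.comp_def, det_transferMat]
  -- `Z` encodes the second column of `T`, which cannot vanish when `det T = 1`; its modulus and
  -- argument are the amplitude and phase of the limiting sine.
  have hZ0 : Z ≠ 0 := by
    intro h
    have h1 : T 1 1 = 0 := by simpa [hZ] using congrArg Complex.re h
    have h2 : T 0 1 = 0 := by simpa [hZ] using congrArg Complex.im h
    rw [Matrix.det_fin_two, h1, h2] at hdet
    simp at hdet
  set B : ℝ := (Real.sin θ)⁻¹ * ‖Z‖ with hB
  have hB0 : B ≠ 0 := mul_ne_zero (inv_ne_zero hsθ.ne') (norm_ne_zero_iff.2 hZ0)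
  set Fc : ℂ → ℂ := fun z => B * Complex.sin (z * κ + g) with hFc
  set G : ℕ → ℂ → ℂ := fun k z =>
    charSeq (fun j => ((a j * w j : ℝ) : ℂ)) ((2 * Real.cos θ : ℝ) + z / L k) (L k) with hG
  have hcosZ : ‖Z‖ * Real.cos Z.arg = -T 1 1 := Complex.norm_mul_cos_arg Z
  have hsinZ : ‖Z‖ * Real.sin Z.arg = T 0 1 := Complex.norm_mul_sin_arg Z
  have hlimC : TendstoLocallyUniformly G Fc atTop := by
    rw [tendstoLocallyUniformly_iff_forall_tendsto]
    intro z₀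
    -- Convergence in `k` and `z` jointly, together with continuity of the limit, amounts to locally
    -- uniform convergence.
    have hGz : Tendsto (fun q : ℕ × ℂ => G q.1 q.2) (atTop ×ˢ 𝓝 z₀) (𝓝 (Fc z₀)) := by
      have := tendsto_charSeq hsθ.ne' hT (l := atTop ×ˢ 𝓝 z₀) (fun q : ℕ × ℂ => L q.1)
        (hL.comp tendsto_fst) (z := fun q => q.2) tendsto_snd
        (hc.comp tendsto_fst) (hs.comp tendsto_fst)
      convert! this using 2
      · simp only [hG]
        push_cast
        rfl
      · have e : z₀ * κ + g = z₀ * ((2 * Real.sin θ)⁻¹ : ℂ) - φ + Z.arg := by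
          rw [hg, limitPhase, hκ]
          push_cast
          ring
        have hcosZ' : (‖Z‖ : ℂ) * Complex.cos Z.arg = -T 1 1 := by exact_mod_cast hcosZ
        have hsinZ' : (‖Z‖ : ℂ) * Complex.sin Z.arg = T 0 1 := by exact_mod_cast hsinZ
        simp only [hFc]
        rw [e, Complex.sin_add, hB]
        push_cast
        linear_combination (Complex.sin θ)⁻¹ *
          Complex.sin (z₀ * (2 * Complex.sin θ)⁻¹ - φ) * hcosZ' +
          (Complex.sin θ)⁻¹ * Complex.cos (z₀ * (2 * Complex.sin θ)⁻¹ - φ) * hsinZ'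
    have hcont : Continuous Fc := by simp only [hFc]; fun_prop
    have hFz : Tendsto (fun q : ℕ × ℂ => Fc q.2) (atTop ×ˢ 𝓝 z₀) (𝓝 (Fc z₀)) :=
      hcont.continuousAt.tendsto.comp tendsto_snd
    exact (hFz.prodMk_nhds hGz).mono_right (nhds_le_uniformity _)
  have hGd : ∀ k, Differentiable ℂ (G k) := fun k => differentiable_charSeq _ _ _ _
  have hFd : Differentiable ℂ Fc := by simp only [hFc]; fun_prop
  -- Holomorphy is what makes derivatives converge, hence the detour through complex `z`.
  have hlimC' : TendstoLocallyUniformly (fun k => deriv (G k)) (deriv Fc) atTop := by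
    rw [← tendstoLocallyUniformlyOn_univ] at hlimC ⊢
    exact hlimC.deriv (Eventually.of_forall fun k => (hGd k).differentiableOn) isOpen_univ
  have hre : ∀ {H : ℕ → ℂ → ℂ} {H' : ℂ → ℂ}, TendstoLocallyUniformly H H' atTop →
      TendstoLocallyUniformly (fun k (x : ℝ) => (H k x).re) (fun x : ℝ => (H' x).re) atTop :=
    fun h => Complex.reCLM.uniformContinuous.comp_tendstoLocallyUniformly
      (h.comp _ Complex.continuous_ofReal)
  have hFre : (fun x : ℝ => (Fc x).re) = fun x => B * Real.sin (x * κ + g) := by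
    funext x
    simp only [hFc]
    rw [← Complex.ofReal_mul, ← Complex.ofReal_add, ← Complex.ofReal_sin, ← Complex.ofReal_mul,
      Complex.ofReal_re]
  have hderivF : deriv (fun x : ℝ => (Fc x).re) = fun x : ℝ => (deriv Fc x).re :=
    funext fun x => ((hFd x).hasDerivAt.real_of_complex).deriv
  have hderivG : ∀ k, deriv (fun x : ℝ => (G k x).re) = fun x : ℝ => (deriv (G k) x).re :=
    fun k => funext fun x => ((hGd k x).hasDerivAt.real_of_complex).deriv
  have hderivF' : deriv (fun x : ℝ => (Fc x).re) =
      fun x => B * (Real.cos (x * κ + g) * κ) := by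
    rw [hFre]
    funext x
    have := (((((hasDerivAt_id x).mul_const κ).add_const g).sin).const_mul B).deriv
    simp only [id_eq, one_mul] at this
    exact this
  rw [LocFinMeasure.tendsto_iff]
  intro f
  have := isLocallyFiniteMeasure_clock θ hθ g
  have : ∀ k, IsLocallyFiniteMeasure (Measure.sum fun i => Measure.dirac
      ((rescaledBoxOp_isHermitian a w (2 * Real.cos θ) (L k)).eigenvalues i)) :=
    fun k => (eigenvalueProcess a w (2 * Real.cos θ) (L k)).2
  have hzero : ∀ x, (fun x : ℝ => (Fc x).re) x = 0 ↔
      ∃ j : ℤ, -2 * ((j : ℝ) * Real.pi + g) * Real.sin θ = x := by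
    intro x
    rw [hFre]
    simp only [mul_eq_zero, hB0, false_or, Real.sin_eq_zero_iff]
    have hx : ∀ j : ℤ, (j : ℝ) * Real.pi = x * κ + g ↔
        -2 * (((-j : ℤ) : ℝ) * Real.pi + g) * Real.sin θ = x := by
      intro j
      rw [hκ]
      push_cast
      field_simp
      constructor <;> intro h <;> linarith
    constructor
    · rintro ⟨j, hj⟩
      exact ⟨-j, (hx j).1 hj⟩
    · rintro ⟨j, hj⟩
      exact ⟨-j, (hx (-j)).2 (by rwa [neg_neg])⟩
  refine tendsto_integral_of_roots (c := fun k => ((L k : ℝ) ^ L k)⁻¹)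
    (f := fun k x => (G k x).re) (F := fun x => (Fc x).re) ?_ ?_ ?_ (hre hlimC) ?_ ?_ hzero ?_
    f.continuous f.hasCompactSupport
  · filter_upwards [hL.eventually_gt_atTop 0] with k hk
    have hk' : (L k : ℝ) ≠ 0 := by exact_mod_cast hk.ne'
    refine ⟨inv_ne_zero (pow_ne_zero _ hk'), funext fun x => ?_⟩
    simp only [hG]
    rw [charSeq_eq_prod_eigenvalues a w _ hk.ne' x]
    have : (∏ i, ((x : ℂ) - ((rescaledBoxOp_isHermitian a w (2 * Real.cos θ) (L k)).eigenvalues i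
        : ℂ))) = ((∏ i, (x - (rescaledBoxOp_isHermitian a w (2 * Real.cos θ) (L k)).eigenvalues i)
        : ℝ) : ℂ) := by
      push_cast
      rfl
    rw [this, ← Complex.ofReal_mul, Complex.ofReal_re]
  · rw [hFre]; fun_prop
  · rw [hderivF']; fun_prop
  · simp only [hderivG, hderivF]
    exact hre hlimC'
  · intro i j hij
    have h1 : (i : ℝ) * Real.pi = j * Real.pi := by
      have := mul_right_cancel₀ hsθ.ne' hij
      linarith
    exact_mod_cast mul_right_cancel₀ Real.pi_ne_zero h1
  · intro x hx
    rw [hderivF']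
    have hx' := congrFun hFre x
    rw [hx'] at hx
    have hsin : Real.sin (x * κ + g) = 0 := (mul_eq_zero.1 hx).resolve_left hB0
    have hcos : Real.cos (x * κ + g) ≠ 0 := by
      intro h
      have := Real.sin_sq_add_cos_sq (x * κ + g)
      rw [hsin, h] at this
      norm_num at this
    exact mul_ne_zero hB0 (mul_ne_zero hcos hκ0)

/-! ### Random products of matrices -/

section RandomProduct

variable {Ω : Type*} [mΩ : MeasurableSpace Ω] {P : Measure Ω}

/-- The σ-algebras generated by the variables of index `< n`. -/
def strictPast (β : ℕ → Ω → ℝ) (hβ : ∀ n, Measurable (β n)) : Filtration ℕ mΩ where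
  seq n := ⨆ k ∈ {k | k < n}, MeasurableSpace.comap (β k) inferInstance
  mono' _ _ h := biSup_mono fun _ hk => lt_of_lt_of_le hk h
  le' _ := iSup₂_le fun k _ => (hβ k).comap_le

theorem measurable_strictPast (β : ℕ → Ω → ℝ) (hβ : ∀ n, Measurable (β n)) {k n : ℕ} (h : k < n) :
    Measurable[strictPast β hβ n] (β k) := by
  rw [measurable_iff_comap_le]
  exact le_iSup₂_of_le (f := fun k (_ : k ∈ {k | k < n}) =>
    MeasurableSpace.comap (β k) inferInstance) k h le_rfl

/-- `β n` is independent of everything before time `n`. Used both for the martingale property and to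
cancel the cross terms in the second moment. -/
theorem integral_mul_eq_zero_of_strictPast [IsProbabilityMeasure P] {β : ℕ → Ω → ℝ}
    (hβ : ∀ n, Measurable (β n)) (hind : iIndepFun β P) (hmean : ∀ n, ∫ x, β n x ∂P = 0)
    {n : ℕ} {W : Ω → ℝ} (hW : Measurable[strictPast β hβ n] W) :
    ∫ x, β n x * W x ∂P = 0 := by
  have h1 : Indep (⨆ k ∈ ({n} : Set ℕ), MeasurableSpace.comap (β k) inferInstance)
      (⨆ k ∈ {k | k < n}, MeasurableSpace.comap (β k) inferInstance) P :=
    indep_iSup_of_disjoint (m := fun k => MeasurableSpace.comap (β k) inferInstance)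
      (fun k => (hβ k).comap_le) hind (by simp)
  have h2 : IndepFun (β n) W P := by
    rw [IndepFun_iff_Indep]
    refine indep_of_indep_of_le_left (indep_of_indep_of_le_right h1 ?_) ?_
    · exact measurable_iff_comap_le.1 hW
    · simp
  rw [h2.integral_fun_mul_eq_mul_integral (hβ n).aestronglyMeasurable
    (hW.mono ((strictPast β hβ).le n) le_rfl).aestronglyMeasurable, hmean, zero_mul]

/-- An ordered product of the matrices `1 - β n • A n`, with independent centred `β n` of square
summable size and bounded deterministic `A n`, converges almost surely. -/
theorem ae_tendsto_orderedProd_one_sub_smul [IsProbabilityMeasure P] {β : ℕ → Ω → ℝ}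
    (hβ : ∀ n, Measurable (β n)) (hind : iIndepFun β P) (hmean : ∀ n, ∫ x, β n x ∂P = 0)
    {c : ℕ → ℝ} (hc : ∀ n x, |β n x| ≤ c n) (hsum : Summable fun n => c n ^ 2)
    {A : ℕ → Matrix (Fin 2) (Fin 2) ℝ} {K : ℝ} (hA : ∀ n i j, |A n i j| ≤ K) (i j : Fin 2) :
    ∀ᵐ x ∂P, ∃ t, Tendsto (fun n => orderedProd (fun k => 1 - β k x • A k) n i j) atTop (𝓝 t) := by
  -- The column `j` is fixed and evolves by itself: its increment is `-β n` times the vector `Y n`,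
  -- which depends on the past only.
  set X : ℕ → Fin 2 → Ω → ℝ := fun n i x => orderedProd (fun k => 1 - β k x • A k) n i j with hX
  set Y : ℕ → Fin 2 → Ω → ℝ := fun n i x => A n i 0 * X n 0 x + A n i 1 * X n 1 x with hY
  have hstep : ∀ n i x, X (n + 1) i x = X n i x - β n x * Y n i x := by
    intro n i x
    simp only [hX, hY, orderedProd]
    rw [sub_mul, one_mul, Matrix.smul_mul]
    simp only [Matrix.sub_apply, Matrix.smul_apply, Matrix.mul_apply, Fin.sum_univ_two,
      smul_eq_mul]
  have hK : 0 ≤ K := (abs_nonneg _).trans (hA 0 0 0)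
  have hc0 : ∀ n, 0 ≤ c n := by
    intro n
    obtain ⟨x⟩ := P.nonempty_of_neZero
    exact (abs_nonneg _).trans (hc n x)
  have hXm : ∀ n i, Measurable[strictPast β hβ n] (X n i) := by
    intro n
    induction n with
    | zero => intro i; simp only [hX, orderedProd]; exact measurable_const
    | succ n ih =>
      intro i
      have hm : ∀ i, Measurable[strictPast β hβ (n + 1)] (X n i) := fun i =>
        (ih i).mono ((strictPast β hβ).mono (Nat.le_succ n)) le_rfl
      have : X (n + 1) i = fun x => X n i x - β n x * (A n i 0 * X n 0 x + A n i 1 * X n 1 x) :=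
        funext fun x => hstep n i x
      rw [this]
      exact (hm i).sub ((measurable_strictPast β hβ (Nat.lt_succ_self n)).mul
        (((hm 0).const_mul _).add ((hm 1).const_mul _)))
  have hXb : ∀ n, ∃ C, ∀ i x, |X n i x| ≤ C := by
    intro n
    induction n with
    | zero =>
      refine ⟨1, fun i x => ?_⟩
      simp only [hX, orderedProd, Matrix.one_apply]
      split_ifs <;> simp
    | succ n ih =>
      obtain ⟨C, hC⟩ := ih
      refine ⟨C + c n * (K * C + K * C), fun i x => ?_⟩
      rw [hstep]
      refine (abs_sub _ _).trans (add_le_add (hC i x) ?_)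
      rw [abs_mul]
      refine mul_le_mul (hc n x) ((abs_add_le _ _).trans (add_le_add ?_ ?_)) (abs_nonneg _) (hc0 n)
      · rw [abs_mul]; exact mul_le_mul (hA n i 0) (hC 0 x) (abs_nonneg _) hK
      · rw [abs_mul]; exact mul_le_mul (hA n i 1) (hC 1 x) (abs_nonneg _) hK
  have hXm' : ∀ n i, Measurable (X n i) := fun n i =>
    (hXm n i).mono ((strictPast β hβ).le n) le_rfl
  have hYm : ∀ n i, Measurable[strictPast β hβ n] (Y n i) := fun n i =>
    ((hXm n 0).const_mul _).add ((hXm n 1).const_mul _)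
  have hYm' : ∀ n i, Measurable (Y n i) := fun n i =>
    (hYm n i).mono ((strictPast β hβ).le n) le_rfl
  have hint : ∀ {f : Ω → ℝ}, Measurable f → (∃ C, ∀ x, |f x| ≤ C) → Integrable f P := by
    rintro f hf ⟨C, hC⟩
    exact Integrable.of_bound hf.aestronglyMeasurable C (Eventually.of_forall hC)
  have hXi : ∀ n i, Integrable (X n i) P := fun n i =>
    let ⟨C, hC⟩ := hXb n
    hint (hXm' n i) ⟨C, hC i⟩
  have hYb : ∀ n i, ∃ C, ∀ x, |Y n i x| ≤ C := by
    intro n i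
    obtain ⟨C, hC⟩ := hXb n
    refine ⟨K * C + K * C, fun x => (abs_add_le _ _).trans (add_le_add ?_ ?_)⟩
    · rw [abs_mul]; exact mul_le_mul (hA n i 0) (hC 0 x) (abs_nonneg _) hK
    · rw [abs_mul]; exact mul_le_mul (hA n i 1) (hC 1 x) (abs_nonneg _) hK
  have hbmul : ∀ {f g : Ω → ℝ}, (∃ C, ∀ x, |f x| ≤ C) → (∃ C, ∀ x, |g x| ≤ C) →
      ∃ C, ∀ x, |f x * g x| ≤ C := by
    rintro f g ⟨C, hC⟩ ⟨D, hD⟩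
    refine ⟨C * D, fun x => ?_⟩
    rw [abs_mul]
    exact mul_le_mul (hC x) (hD x) (abs_nonneg _) ((abs_nonneg _).trans (hC x))
  have hmart : ∀ i, Martingale (fun n => X n i) (strictPast β hβ) P := by
    intro i
    refine martingale_of_setIntegral_eq_succ (fun n => (hXm n i).stronglyMeasurable)
      (fun n => hXi n i) fun n s hs => ?_
    have hs' : MeasurableSet s := (strictPast β hβ).le n s hs
    have h0 : ∫ x in s, β n x * Y n i x ∂P = 0 := by
      rw [← integral_indicator hs']
      have : (s.indicator fun x => β n x * Y n i x) = fun x => β n x * s.indicator (Y n i) x := by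
        funext x
        by_cases hx : x ∈ s <;> simp [hx]
      rw [this]
      exact integral_mul_eq_zero_of_strictPast hβ hind hmean ((hYm n i).indicator hs)
    have hβY : Integrable (fun x => β n x * Y n i x) P :=
      hint ((hβ n).mul (hYm' n i)) (hbmul ⟨c n, hc n⟩ (hYb n i))
    simp only [hstep]
    rw [integral_sub (hXi n i).integrableOn hβY.integrableOn, h0, sub_zero]
  set V : ℕ → ℝ := fun n => ∫ x, X n 0 x ^ 2 + X n 1 x ^ 2 ∂P with hV
  have hX2i : ∀ n i, Integrable (fun x => X n i x ^ 2) P := by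
    intro n i
    obtain ⟨C, hC⟩ := hXb n
    simp only [pow_two]
    exact hint ((hXm' n i).mul (hXm' n i)) (hbmul ⟨C, hC i⟩ ⟨C, hC i⟩)
  have hV0 : ∀ n, 0 ≤ V n := fun n => integral_nonneg fun x => by positivity
  -- The cross terms integrate to zero. Each of the two rows has `Y ^ 2` at most `2 * K ^ 2` times
  -- the squared length of the column, which gives the factor 4.
  have hVstep : ∀ n, V (n + 1) ≤ (1 + 4 * K ^ 2 * c n ^ 2) * V n := by
    intro n
    have hcross : ∀ i, ∫ x, β n x * (Y n i x * X n i x) ∂P = 0 := fun i =>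
      integral_mul_eq_zero_of_strictPast hβ hind hmean ((hYm n i).mul (hXm n i))
    have hcrossi : ∀ i, Integrable (fun x => β n x * (Y n i x * X n i x)) P := by
      intro i
      obtain ⟨C, hC⟩ := hXb n
      exact hint ((hβ n).mul ((hYm' n i).mul (hXm' n i)))
        (hbmul ⟨c n, hc n⟩ (hbmul (hYb n i) ⟨C, hC i⟩))
    have hsum2 : Integrable (fun x => X n 0 x ^ 2 + X n 1 x ^ 2) P := (hX2i n 0).add (hX2i n 1)
    have hcross2 : Integrable (fun x => 2 * (β n x * (Y n 0 x * X n 0 x) +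
        β n x * (Y n 1 x * X n 1 x))) P := ((hcrossi 0).add (hcrossi 1)).const_mul 2
    have hle : V (n + 1) ≤ ∫ x, (1 + 4 * K ^ 2 * c n ^ 2) * (X n 0 x ^ 2 + X n 1 x ^ 2) -
        2 * (β n x * (Y n 0 x * X n 0 x) + β n x * (Y n 1 x * X n 1 x)) ∂P := by
      refine integral_mono ((hX2i _ 0).add (hX2i _ 1)) ((hsum2.const_mul _).sub
        hcross2) fun x => ?_
      simp only [hstep]
      have hYsq : ∀ i, Y n i x ^ 2 ≤ 2 * K ^ 2 * (X n 0 x ^ 2 + X n 1 x ^ 2) := by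
        intro i
        have h0 : (A n i 0) ^ 2 ≤ K ^ 2 := sq_le_sq' (abs_le.1 (hA n i 0)).1 (abs_le.1 (hA n i 0)).2
        have h1 : (A n i 1) ^ 2 ≤ K ^ 2 := sq_le_sq' (abs_le.1 (hA n i 1)).1 (abs_le.1 (hA n i 1)).2
        have e : Y n i x = A n i 0 * X n 0 x + A n i 1 * X n 1 x := rfl
        rw [e]
        nlinarith [sq_nonneg (A n i 0 * X n 0 x - A n i 1 * X n 1 x),
          mul_le_mul_of_nonneg_right h0 (sq_nonneg (X n 0 x)),
          mul_le_mul_of_nonneg_right h1 (sq_nonneg (X n 1 x))]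
      have hβsq : β n x ^ 2 ≤ c n ^ 2 := sq_le_sq' (abs_le.1 (hc n x)).1 (abs_le.1 (hc n x)).2
      have hprod : ∀ i, β n x ^ 2 * Y n i x ^ 2 ≤
          c n ^ 2 * (2 * K ^ 2 * (X n 0 x ^ 2 + X n 1 x ^ 2)) := fun i =>
        mul_le_mul hβsq (hYsq i) (sq_nonneg _) (sq_nonneg _)
      nlinarith [hprod 0, hprod 1]
    refine hle.trans (le_of_eq ?_)
    rw [integral_sub (hsum2.const_mul _) hcross2,
      integral_const_mul, integral_const_mul, integral_add (hcrossi 0) (hcrossi 1), hcross, hcross]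
    simp [hV]
  have hVb : ∀ n, V n ≤ Real.exp (∑ k ∈ Finset.range n, 4 * K ^ 2 * c k ^ 2) * V 0 := by
    intro n
    induction n with
    | zero => simp
    | succ n ih =>
      rw [Finset.sum_range_succ, add_comm (∑ k ∈ _, _), Real.exp_add, mul_assoc]
      refine (hVstep n).trans (mul_le_mul ?_ ih (hV0 n) (Real.exp_nonneg _))
      linarith [Real.add_one_le_exp (4 * K ^ 2 * c n ^ 2)]
  set M : ℝ := Real.exp (∑' k, 4 * K ^ 2 * c k ^ 2) * V 0 with hM
  have hVM : ∀ n, V n ≤ M := by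
    intro n
    refine (hVb n).trans (mul_le_mul_of_nonneg_right (Real.exp_le_exp.2 ?_) (hV0 0))
    exact (hsum.mul_left (4 * K ^ 2)).sum_le_tsum _ fun k _ => by positivity
  have hM0 : 0 ≤ M := (hV0 0).trans (hVM 0)
  -- The second moment bound gives the required L¹ bound through `|x| ≤ 1 + x ^ 2`.
  refine (hmart i).submartingale.exists_ae_tendsto_of_bdd (R := ⟨1 + M, by positivity⟩) fun n => ?_
  rw [eLpNorm_one_eq_lintegral_enorm, ← ofReal_integral_norm_eq_lintegral_enorm (hXi n i)]
  have hle : ∫ x, ‖X n i x‖ ∂P ≤ 1 + M := by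
    calc ∫ x, ‖X n i x‖ ∂P ≤ ∫ x, 1 + (X n 0 x ^ 2 + X n 1 x ^ 2) ∂P := by
          refine integral_mono (hXi n i).norm
            ((integrable_const 1).add ((hX2i n 0).add (hX2i n 1))) fun x => ?_
          have h1 : X n i x ^ 2 ≤ X n 0 x ^ 2 + X n 1 x ^ 2 := by
            fin_cases i
            · exact le_add_of_nonneg_right (sq_nonneg _)
            · exact le_add_of_nonneg_left (sq_nonneg _)
          rw [Real.norm_eq_abs]
          have h2 := sq_abs (X n i x)
          simp only
          nlinarith [sq_nonneg (|X n i x| - 1)]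
      _ = 1 + V n := by
          have h2 : Integrable (fun x => X n 0 x ^ 2 + X n 1 x ^ 2) P :=
            (hX2i n 0).add (hX2i n 1)
          rw [integral_add (integrable_const 1) h2]
          simp [hV]
      _ ≤ 1 + M := by linarith [hVM n]
  calc ENNReal.ofReal (∫ x, ‖X n i x‖ ∂P) ≤ ENNReal.ofReal (1 + M) := ENNReal.ofReal_le_ofReal hle
    _ = _ := by rw [ENNReal.ofReal_eq_coe_nnreal (by positivity)]; rfl

end RandomProduct

/-! ### Almost sure convergence of the transfer matrices -/

/-- Beyond the last disagreement the two products differ by a fixed right factor, obtained by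
inverting one of them with its adjugate. -/
theorem exists_tendsto_transferMat_of_eventuallyEq {θ : ℝ} {b b' : ℕ → ℝ} (h : b =ᶠ[atTop] b')
    {T : Matrix (Fin 2) (Fin 2) ℝ} (hT : Tendsto (transferMat θ b') atTop (𝓝 T)) :
    ∃ T', Tendsto (transferMat θ b) atTop (𝓝 T') := by
  obtain ⟨N, hN⟩ := eventually_atTop.1 h
  set S := (transferMat θ b' N).adjugate * transferMat θ b N with hS
  have hfac : ∀ n, N ≤ n → transferMat θ b n = transferMat θ b' n * S := by
    intro n hn
    induction n, hn using Nat.le_induction with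
    | base =>
      rw [hS, ← mul_assoc, Matrix.mul_adjugate, det_transferMat, one_smul, one_mul]
    | succ n hn ih =>
      have h1 : transferMat θ b (n + 1) = (1 - b n • siteMat θ n) * transferMat θ b n := rfl
      have h2 : transferMat θ b' (n + 1) = (1 - b' n • siteMat θ n) * transferMat θ b' n := rfl
      rw [h1, h2, ih, hN n hn, mul_assoc]
  refine ⟨T * S, (hT.mul_const S).congr' ?_⟩
  filter_upwards [eventually_ge_atTop N] with n hn
  rw [hfac n hn]

theorem abs_siteMat_le (θ : ℝ) (n : ℕ) (i j : Fin 2) : |siteMat θ n i j| ≤ |(Real.sin θ)⁻¹| := by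
  have hs := Real.abs_sin_le_one ((n + 1) * θ)
  have hc := Real.abs_cos_le_one ((n + 1) * θ)
  have key : ∀ x y : ℝ, |x| ≤ 1 → |y| ≤ 1 →
      |(Real.sin θ)⁻¹| * (|x| * |y|) ≤ |(Real.sin θ)⁻¹| := fun x y hx hy =>
    mul_le_of_le_one_right (abs_nonneg _) (mul_le_one₀ hx (abs_nonneg _) hy)
  fin_cases i <;> fin_cases j <;>
    simp only [siteMat, Matrix.smul_apply, smul_eq_mul, Matrix.of_apply, Matrix.cons_val',
      Matrix.cons_val_zero, Matrix.cons_val_one, Matrix.cons_val_fin_one, Fin.zero_eta,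
      Fin.mk_one, abs_mul, abs_neg]
  · exact key _ _ hs hc
  · exact key _ _ hs hs
  · exact key _ _ hc hc
  · exact key _ _ hs hc

theorem summable_nat_add_one_rpow {p : ℝ} (hp : p < -1) :
    Summable fun n : ℕ => ((n : ℝ) + 1) ^ p := by
  have := (summable_nat_add_iff 1).2 (Real.summable_nat_rpow.2 hp)
  simpa using this

theorem ae_exists_tendsto_transferMat {Ω : Type*} [MeasurableSpace Ω] (P : Measure Ω)
    [IsProbabilityMeasure P] (μ : Measure ℝ) [IsProbabilityMeasure μ]
    (hsymm : ∀ K : ℝ, 0 < K → ∫ x in Icc (-K) K, x ∂μ = 0)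
    {δ : ℝ} (hδ : 0 < δ)
    (htail : ∃ C : ℝ, ∀ᶠ R : ℝ in atTop, μ.real (Ioo (-R) R)ᶜ ≤ C / R ^ δ)
    (ω : ℕ → Ω → ℝ) (hmeas : ∀ i, Measurable (ω i)) (hindep : iIndepFun ω P)
    (hlaw : ∀ i, P.map (ω i) = μ) {α : ℝ} (hα : α - 1 / δ > 1 / 2)
    {a : ℕ → ℝ} (ha : a =O[atTop] fun i : ℕ => ((i : ℝ) + 1) ^ (-α)) (θ : ℝ) :
    ∀ᵐ x ∂P, ∃ T, Tendsto (transferMat θ fun j => a j * ω j x) atTop (𝓝 T) := by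
  -- The lower bound makes the tail probabilities `n ^ (-γ δ)` summable; the upper bound makes `(a n
  -- * n ^ γ) ^ 2` summable.
  obtain ⟨γ, hγ1, hγ2⟩ : ∃ γ, 1 / δ < γ ∧ γ < α - 1 / 2 := exists_between (by linarith)
  have hγ0 : 0 < γ := lt_trans (by positivity) hγ1
  have hγδ : 1 < γ * δ := (div_lt_iff₀ hδ).1 hγ1
  set K : ℕ → ℝ := fun n => ((n : ℝ) + 1) ^ γ with hK
  have hK0 : ∀ n, 0 < K n := fun n => Real.rpow_pos_of_pos (by positivity) _
  -- Truncation to a closed symmetric interval, so that symmetry of `μ` gives mean zero exactly.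
  set h : ℕ → ℝ → ℝ := fun n => (Icc (-K n) (K n)).indicator fun x => a n * x with hh
  have hhm : ∀ n, Measurable (h n) := fun n =>
    (measurable_id.const_mul (a n)).indicator measurableSet_Icc
  have hhb : ∀ n x, |h n x| ≤ |a n| * K n := by
    intro n x
    by_cases hx : x ∈ Icc (-K n) (K n)
    · simp only [hh, indicator_of_mem hx, abs_mul]
      exact mul_le_mul_of_nonneg_left (abs_le.2 hx) (abs_nonneg _)
    · simp only [hh, indicator_of_notMem hx, abs_zero]
      exact mul_nonneg (abs_nonneg _) (hK0 n).le
  have hmean : ∀ n, ∫ x, h n (ω n x) ∂P = 0 := by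
    intro n
    rw [← integral_map (hmeas n).aemeasurable (hhm n).aestronglyMeasurable, hlaw,
      integral_indicator measurableSet_Icc, integral_const_mul, hsymm _ (hK0 n), mul_zero]
  have hsum : Summable fun n => (|a n| * K n) ^ 2 := by
    refine summable_of_isBigO_nat (summable_nat_add_one_rpow (p := (-α + γ) * 2) (by linarith)) ?_
    have h1 : (fun n => |a n| * K n) =O[atTop] fun n : ℕ => ((n : ℝ) + 1) ^ (-α) * K n :=
      ha.norm_left.mul (isBigO_refl _ _)
    refine (h1.pow 2).congr_right fun n => ?_
    have hn : (0 : ℝ) < (n : ℝ) + 1 := by positivity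
    rw [hK, ← Real.rpow_add hn, Real.rpow_mul hn.le, Real.rpow_two]
  have hind : iIndepFun (fun n x => h n (ω n x)) P := hindep.comp h hhm
  have hT : ∀ᵐ x ∂P, ∀ i j, ∃ t, Tendsto (fun n => transferMat θ (fun k => h k (ω k x)) n i j)
      atTop (𝓝 t) := by
    rw [ae_all_iff]
    intro i
    rw [ae_all_iff]
    intro j
    exact ae_tendsto_orderedProd_one_sub_smul (fun n => (hhm n).comp (hmeas n)) hind hmean
      (fun n x => hhb n (ω n x)) hsum (abs_siteMat_le θ) i j
  have hBC : ∀ᵐ x ∂P, ∀ᶠ n in atTop, x ∉ {x | ω n x ∉ Ioo (-K n) (K n)} := by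
    refine ae_eventually_notMem ?_
    obtain ⟨C, hC⟩ := htail
    have hreal : ∀ n, P {x | ω n x ∉ Ioo (-K n) (K n)} =
        ENNReal.ofReal (μ.real (Ioo (-K n) (K n))ᶜ) := by
      intro n
      rw [ofReal_measureReal, ← hlaw n, Measure.map_apply (hmeas n) measurableSet_Ioo.compl]
      rfl
    simp only [hreal]
    refine Summable.tsum_ofReal_ne_top ?_
    have hKtop : Tendsto K atTop atTop :=
      (tendsto_rpow_atTop hγ0).comp (tendsto_natCast_atTop_atTop.atTop_add tendsto_const_nhds)
    refine summable_of_isBigO_nat (summable_nat_add_one_rpow (p := -(γ * δ)) (by linarith))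
      (IsBigO.of_bound |C| ?_)
    filter_upwards [hKtop.eventually hC] with n hn
    have hn1 : (0 : ℝ) < (n : ℝ) + 1 := by positivity
    rw [Real.norm_of_nonneg measureReal_nonneg,
      Real.norm_of_nonneg (Real.rpow_nonneg hn1.le _)]
    refine hn.trans ?_
    rw [hK, ← Real.rpow_mul hn1.le, Real.rpow_neg hn1.le, div_eq_mul_inv]
    exact mul_le_mul_of_nonneg_right (le_abs_self C) (inv_nonneg.2 (Real.rpow_nonneg hn1.le _))
  filter_upwards [hT, hBC] with x hx1 hx2
  choose t ht using hx1
  have hT' : Tendsto (transferMat θ fun k => h k (ω k x)) atTop (𝓝 (Matrix.of t)) :=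
    tendsto_pi_nhds.2 fun i => tendsto_pi_nhds.2 fun j => ht i j
  refine exists_tendsto_transferMat_of_eventuallyEq ?_ hT'
  filter_upwards [hx2] with n hn
  have hmem : ω n x ∈ Icc (-K n) (K n) := Ioo_subset_Icc_self (not_not.1 hn)
  simp only [hh, indicator_of_mem hmem]

/-! ### Measurability and convergence in distribution -/

theorem LocFinMeasure.continuous_iff {X : Type*} [TopologicalSpace X] {m : X → LocFinMeasure} :
    Continuous m ↔ ∀ f : C_c(ℝ, ℝ), Continuous fun x => ∫ y, f y ∂(m x).1 := by
  simp only [continuous_iff_continuousAt, ContinuousAt, LocFinMeasure.tendsto_iff]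
  exact forall_comm

section

open scoped Matrix.Norms.L2Operator

theorem continuous_rescaledBoxOp (a : ℕ → ℝ) (E₀ : ℝ) (L : ℕ) :
    Continuous fun w : ℕ → ℝ => rescaledBoxOp a w E₀ L := by
  refine continuous_matrix fun i j => ?_
  simp only [rescaledBoxOp, Matrix.smul_apply, Matrix.sub_apply, boxOp_apply]
  split_ifs <;> fun_prop

/-- Integrals against the process are traces of the functional calculus, which is continuous in the
matrix; individual eigenvalues need not be followed. Measurability of the process results. -/
theorem continuous_eigenvalueProcess (a : ℕ → ℝ) (E₀ : ℝ) (L : ℕ) :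
    Continuous fun w : ℕ → ℝ => eigenvalueProcess a w E₀ L := by
  rw [LocFinMeasure.continuous_iff]
  intro f
  have hcfc : Continuous fun w : ℕ → ℝ => cfc (fun x : ℝ => f x) (rescaledBoxOp a w E₀ L) :=
    (continuous_rescaledBoxOp a E₀ L).cfc_of_mem_nhdsSet (s := univ) (fun x : ℝ => f x) univ_mem
      (fun w => rescaledBoxOp_isHermitian a w E₀ L) f.continuous.continuousOn
  have htr := Complex.continuous_re.comp hcfc.matrix_trace
  refine htr.congr fun w => ?_
  rw [Function.comp_apply, ← integral_eigenvalueProcess, Complex.ofReal_re]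

end

theorem continuous_clockMeasure {θ : ℝ} (hθ : θ ∈ Ioo 0 Real.pi) :
    Continuous (clockMeasure θ hθ) := by
  rw [LocFinMeasure.continuous_iff]
  intro f
  -- Changing the phase translates the configuration, so the translation can be moved onto the test
  -- function and the measure kept fixed.
  have hshift : ∀ φ, ∫ y, f y ∂(clockMeasure θ hθ φ).1 =
      ∫ y, f (y + -2 * φ * Real.sin θ) ∂(clockMeasure θ hθ 0).1 := by
    intro φ
    have h1 := isLocallyFiniteMeasure_clock θ hθ φ
    have h2 := isLocallyFiniteMeasure_clock θ hθ 0
    refine (integral_sum_dirac (fun k : ℤ => -2 * ((k : ℝ) * Real.pi + φ) * Real.sin θ)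
      f.continuous f.hasCompactSupport).unique ?_
    have := integral_sum_dirac (fun k : ℤ => -2 * ((k : ℝ) * Real.pi + 0) * Real.sin θ)
      (φ := fun y => f (y + -2 * φ * Real.sin θ)) (by fun_prop)
      (f.hasCompactSupport.comp_homeomorph (Homeomorph.addRight (-2 * φ * Real.sin θ)))
    have e : ∀ k : ℤ, -2 * ((k : ℝ) * Real.pi + φ) * Real.sin θ =
        -2 * ((k : ℝ) * Real.pi + 0) * Real.sin θ + -2 * φ * Real.sin θ := fun k => by ring
    simp only [e]
    exact this
  simp only [hshift]
  have := (clockMeasure θ hθ 0).2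
  rw [continuous_iff_continuousAt]
  intro φ₀
  set S := Icc (φ₀ - 1) (φ₀ + 1) with hS
  have hk : IsCompact ((fun q : ℝ × ℝ => q.1 - -2 * q.2 * Real.sin θ) '' (tsupport f ×ˢ S)) :=
    (f.hasCompactSupport.isCompact.prod isCompact_Icc).image (by fun_prop)
  have hcont : ContinuousOn (fun φ => ∫ y, f (y + -2 * φ * Real.sin θ) ∂(clockMeasure θ hθ 0).1)
      S := by
    refine continuousOn_integral_of_compact_support hk
      (f := fun φ y => f (y + -2 * φ * Real.sin θ)) ?_ ?_
    · refine Continuous.continuousOn ?_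
      exact f.continuous.comp (by fun_prop)
    · intro φ y hφ hy
      refine image_eq_zero_of_notMem_tsupport fun hmem => hy ?_
      exact ⟨(y + -2 * φ * Real.sin θ, φ), ⟨hmem, hφ⟩, by simp⟩
  exact hcont.continuousAt (Icc_mem_nhds (by linarith) (by linarith))

/-! ### The main theorem -/

theorem theorem1 {Ω : Type*} [MeasurableSpace Ω] (P : Measure Ω) [IsProbabilityMeasure P]
    (μ : Measure ℝ) [IsProbabilityMeasure μ]
    (hsymm : ∀ K : ℝ, 0 < K → ∫ x in Icc (-K) K, x ∂μ = 0)
    (δ : ℝ) (hδ : 0 < δ)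
    (htail : ∃ C : ℝ, ∀ᶠ R : ℝ in atTop, μ.real (Ioo (-R) R)ᶜ ≤ C / R ^ δ)
    (ω : ℕ → Ω → ℝ) (hmeas : ∀ i, Measurable (ω i)) (hindep : iIndepFun ω P)
    (hlaw : ∀ i, P.map (ω i) = μ)
    (α : ℝ) (hα : α - 1 / δ > 1 / 2)
    (a : ℕ → ℝ) (ha : a =Θ[atTop] fun i : ℕ => ((i : ℝ) + 1) ^ (-α))
    (E₀ : ℝ) (hE₀ : E₀ ∈ Ioo (-2) 2)
    (θ : ℝ) (hθ : θ ∈ Ioo 0 Real.pi) (hθE : E₀ = 2 * Real.cos θ)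
    (L : ℕ → ℕ) (hL : StrictMono L) :
    ∃ s : ℕ → ℕ, StrictMono s ∧
      ∃ g : Ω → ℝ, Measurable g ∧
        TendstoInDistribution
          (fun k (x : Ω) => eigenvalueProcess a (fun i => ω i x) E₀ (L (s k))) atTop
          (fun x => clockMeasure θ hθ (g x)) (fun _ => P) P := by
  subst hθE
  -- The subsequence is deterministic: compactness of the circle makes `(L (s k) + 1) θ` converge
  -- modulo `2 π` to `ζ.arg`.
  obtain ⟨ζ, hζ, s, hs, hlim⟩ := (isCompact_sphere (0 : ℂ) 1).tendsto_subseq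
    (x := fun k => Complex.exp ((((L k : ℝ) + 1) * θ : ℝ) * Complex.I)) (fun k => by
      rw [mem_sphere_zero_iff_norm]
      exact Complex.norm_exp_ofReal_mul_I _)
  rw [mem_sphere_zero_iff_norm] at hζ
  have hcos : Tendsto (fun k => Real.cos (((L (s k) : ℝ) + 1) * θ)) atTop
      (𝓝 (Real.cos ζ.arg)) := by
    have h1 := (Complex.continuous_re.tendsto ζ).comp hlim
    have h2 := Complex.norm_mul_cos_arg ζ
    rw [hζ, one_mul] at h2
    rw [h2]
    exact h1.congr fun k => Complex.exp_ofReal_mul_I_re _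
  have hsin : Tendsto (fun k => Real.sin (((L (s k) : ℝ) + 1) * θ)) atTop
      (𝓝 (Real.sin ζ.arg)) := by
    have h1 := (Complex.continuous_im.tendsto ζ).comp hlim
    have h2 := Complex.norm_mul_sin_arg ζ
    rw [hζ, one_mul] at h2
    rw [h2]
    exact h1.congr fun k => Complex.exp_ofReal_mul_I_im _
  have hae := ae_exists_tendsto_transferMat P μ hsymm hδ htail ω hmeas hindep hlaw hα ha.isBigO θ
  have hTm : ∀ n i j, Measurable fun x => transferMat θ (fun k => a k * ω k x) n i j := by
    intro n
    induction n with
    | zero => intro i j; exact measurable_const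
    | succ n ih =>
      intro i j
      have : (fun x => transferMat θ (fun k => a k * ω k x) (n + 1) i j) = fun x =>
          ∑ l, ((1 : Matrix (Fin 2) (Fin 2) ℝ) i l - a n * ω n x * siteMat θ n i l) *
            transferMat θ (fun k => a k * ω k x) n l j := by
        funext x
        have h1 : transferMat θ (fun k => a k * ω k x) (n + 1) =
          (1 - (a n * ω n x) • siteMat θ n) * transferMat θ (fun k => a k * ω k x) n := rfl
        rw [h1, Matrix.mul_apply]
        simp only [Matrix.sub_apply, Matrix.smul_apply, smul_eq_mul]
      rw [this]
      refine Finset.measurable_fun_sum _ fun l _ => ?_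
      exact (measurable_const.sub (((hmeas n).const_mul _).mul_const _)).mul (ih l j)
  -- Measurable versions of the almost sure limits are selected entry by entry, so that the limiting
  -- phase is a random variable.
  have hentry : ∀ i j, ∃ t : Ω → ℝ, Measurable t ∧ ∀ᵐ x ∂P,
      Tendsto (fun n => transferMat θ (fun k => a k * ω k x) n i j) atTop (𝓝 (t x)) := by
    intro i j
    refine measurable_limit_of_tendsto_metrizable_ae (fun n => (hTm n i j).aemeasurable) ?_
    filter_upwards [hae] with x ⟨T, hT⟩
    exact ⟨T i j, tendsto_pi_nhds.1 (tendsto_pi_nhds.1 hT i) j⟩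
  choose t htm ht using hentry
  have hg : Measurable fun x => limitPhase (Matrix.of fun i j => t i j x) ζ.arg := by
    simp only [limitPhase, Matrix.of_apply, Complex.mk_eq_add_mul_I]
    exact (Complex.measurable_arg.comp ((Complex.measurable_ofReal.comp (htm 1 1).neg).add
      ((Complex.measurable_ofReal.comp (htm 0 1)).mul_const _))).sub_const _
  refine ⟨s, hs, _, hg, tendstoInDistribution_of_ae_tendsto (fun k => ?_)
    ((continuous_clockMeasure hθ).measurable.comp hg).aemeasurable ?_⟩
  · exact ((continuous_eigenvalueProcess a _ _).measurable.comp
      (measurable_pi_lambda _ hmeas)).aemeasurable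
  · filter_upwards [ae_all_iff.2 fun i => ae_all_iff.2 (ht i)] with x hx
    exact tendsto_eigenvalueProcess hθ
      (tendsto_pi_nhds.2 fun i => tendsto_pi_nhds.2 fun j => hx i j)
      (hL.comp hs).tendsto_atTop hcos hsin
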